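/- Let $\mathbb{k}$ be a field, let $S=\mathbb{k}[x_1,\dots,x_n]$ with $n\ge 2$ be standard graded, and let $I=(f_1,\dots,f_n)$, where $f_1,\dots,f_n$ is a regular sequence of homogeneous polynomials of degrees $d_1\le d_2\le\cdots\le d_n$ (so $S/I$ is an Artinian complete intersection). Put $|\underline d|=d_1+\cdots+d_n$. For $a\in\mathbb{Z}$, a \emph{degree $a$ differential module} is a graded $S$-module $D$ with an $S$-linear map $\delta\colon D\to D(a)$ of degree $0$ such that $\delta^2=0$, where $D(c)_m=D_{m+c}$; isomorphisms of such are degree $0$ isomorphisms of graded modules that commute with the differentials. Let $\mathbf F=(F_0\xleftarrow{\partial_1}F_1\xleftarrow{\partial_2}\cdots)$ be a homogeneous complex of finitely generated graded free $S$-modules. A \emph{degree $a$ free flag anchored on $\mathbf F$} is a degree $a$ differential module structure $\delta$ on $\bigoplus_i F_i(ia)$ such that $\delta(F_i)\subseteq\bigoplus_{j<i}F_j$ for all $i$ and the component $F_i\to F_{i-1}$ of $\delta$ is $\partial_i$ for all $i\ge 1$; the \emph{degree $a$ fold} $\operatorname{Fold}^a(\mathbf F)$ is the one whose other components are zero. The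 complex $\mathbf F$ is \emph{$a$-rigid} if every degree $a$ free flag anchored on $\mathbf F$ is isomorphic to $\operatorname{Fold}^a(\mathbf F)$, and a finitely generated graded module is \emph{$a$-rigid} if some homogeneous free resolution of it is $a$-rigid. Then, for every $a\in\mathbb{Z}$, the module $S/I$ fails to be $a$-rigid if and only if $$d_1+d_2+n-|\underline d|\ \le\ a\ \le\ d_{n-1}+d_n .$$ In particular, $S/I$ is not $a$-rigid for any $a$ in this interval (which, when $I$ is generated by linear forms, consists of $a=2$ only). -/

import Mathlib

open scoped DirectSum

universe u

namespace DiffMod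

section Graded

variable {k : Type u} [Field k] {σ : Type}

/-- The standard `ℤ`-grading of the polynomial ring: the piece of degree `m` consists of the forms
of degree `m` (so it is zero for `m < 0`). -/
noncomputable def polyGrading (k : Type u) [Field k] (σ : Type) (m : ℤ) : AddSubgroup (MvPolynomial σ k) where
  carrier := {p | ∀ e : σ →₀ ℕ, p.coeff e ≠ 0 → (e.degree : ℤ) = m}
  zero_mem' := by
    intro e he
    simp at he
  add_mem' := by
    intro p q hp hq e he
    by_cases h : p.coeff e = 0
    · refine hq e fun h' => he ?_
      simp [h, h']
    · exact hp e h
  neg_mem' := by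
    intro p hp e he
    refine hp e fun h => he ?_
    simp [h]

/-- The grading induced on the quotient of the polynomial ring by an ideal: the piece of degree `m`
is the image of the forms of degree `m`. -/
noncomputable def quotientGrading (I : Ideal (MvPolynomial σ k)) (m : ℤ) :
    AddSubgroup (MvPolynomial σ k ⧸ I) :=
  (polyGrading k σ m).map (Ideal.Quotient.mk I : MvPolynomial σ k →+ MvPolynomial σ k ⧸ I)

/-- The family `𝓜` makes `M` a `ℤ`-graded module over the standard graded polynomial ring. -/
structure IsGrading {M : Type u} [AddCommGroup M] [Module (MvPolynomial σ k) M]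
    (𝓜 : ℤ → AddSubgroup M) : Prop where
  isInternal : DirectSum.IsInternal 𝓜
  smul_mem : ∀ (i j : ℤ) (p : MvPolynomial σ k) (x : M),
    p ∈ polyGrading k σ i → x ∈ 𝓜 j → p • x ∈ 𝓜 (i + j)

/-- The graded module `M` is free of finite rank: it has a finite basis of homogeneous elements. -/
def IsGradedFree (k : Type u) [Field k] (σ : Type) {M : Type u} [AddCommGroup M]
    [Module (MvPolynomial σ k) M] (𝓜 : ℤ → AddSubgroup M) : Prop :=
  IsGrading (k := k) (σ := σ) 𝓜 ∧
    ∃ (r : ℕ) (b : Module.Basis (Fin r) (MvPolynomial σ k) M) (deg : Fin r → ℤ),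
      ∀ j, b j ∈ 𝓜 (deg j)

/-- An `S`-linear map is homogeneous of degree `c` if it sends the piece of degree `m` into the
piece of degree `m + c`. -/
def IsHomogeneousMap {M N : Type u} [AddCommGroup M] [AddCommGroup N]
    [Module (MvPolynomial σ k) M] [Module (MvPolynomial σ k) N]
    (𝓜 : ℤ → AddSubgroup M) (𝓝 : ℤ → AddSubgroup N) (c : ℤ)
    (f : M →ₗ[MvPolynomial σ k] N) : Prop :=
  ∀ (m : ℤ) (x : M), x ∈ 𝓜 m → f x ∈ 𝓝 (m + c)

/-- A degree `a` differential module: a square-zero endomorphism `δ : D → D(a)` of the graded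
module `D`. -/
structure IsDifferentialModule {D : Type u} [AddCommGroup D] [Module (MvPolynomial σ k) D]
    (𝓓 : ℤ → AddSubgroup D) (a : ℤ) (δ : D →ₗ[MvPolynomial σ k] D) : Prop where
  sq_zero : δ ∘ₗ δ = 0
  homogeneous : IsHomogeneousMap 𝓓 𝓓 a δ

/-- Isomorphism of graded differential modules: a linear isomorphism that respects the gradings and
commutes with the differentials. -/
def IsIsomorphic {D E : Type u} [AddCommGroup D] [AddCommGroup E]
    [Module (MvPolynomial σ k) D] [Module (MvPolynomial σ k) E]
    (𝓓 : ℤ → AddSubgroup D) (δ : D →ₗ[MvPolynomial σ k] D)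
    (𝓔 : ℤ → AddSubgroup E) (ε : E →ₗ[MvPolynomial σ k] E) : Prop :=
  ∃ e : D ≃ₗ[MvPolynomial σ k] E,
    (∀ (m : ℤ) (x : D), x ∈ 𝓓 m ↔ e x ∈ 𝓔 m) ∧ ∀ x : D, e (δ x) = ε (e x)

end Graded

/-- A homogeneous complex `X 0 ← X 1 ← X 2 ← ⋯` of graded free modules of finite rank over the
standard graded polynomial ring, with differentials homogeneous of degree `0`. -/
structure FreeComplex (k : Type u) [Field k] (σ : Type) where
  X : ℕ → Type u
  [addCommGroup : ∀ i, AddCommGroup (X i)]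
  [module : ∀ i, Module (MvPolynomial σ k) (X i)]
  gr : ∀ i, ℤ → AddSubgroup (X i)
  isGradedFree : ∀ i, IsGradedFree k σ (gr i)
  d : ∀ i, X (i + 1) →ₗ[MvPolynomial σ k] X i
  d_homogeneous : ∀ i, IsHomogeneousMap (gr (i + 1)) (gr i) 0 (d i)
  d_comp_d : ∀ i, d i ∘ₗ d (i + 1) = 0

attribute [instance] FreeComplex.addCommGroup FreeComplex.module

namespace FreeComplex

variable {k : Type u} [Field k] {σ : Type}

/-- The module underlying the folds of the complex. -/
abbrev Total (F : FreeComplex k σ) : Type u := ⨁ i, F.X i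

/-- The grading of `⨁ i, (X i)(i a)`, where `M(c)` has `M (m + c)` in degree `m`. -/
def foldGrading (F : FreeComplex k σ) (a m : ℤ) : AddSubgroup F.Total where
  carrier := {x | ∀ i : ℕ, x i ∈ F.gr i (m + i * a)}
  zero_mem' := fun i => (F.gr i (m + i * a)).zero_mem
  add_mem' := fun {x y} hx hy i => by
    rw [DirectSum.add_apply]
    exact (F.gr i (m + i * a)).add_mem (hx i) (hy i)
  neg_mem' := fun {x} hx i => (F.gr i (m + i * a)).neg_mem (hx i)

/-- The differential of the folds: it is zero on `X 0` and it is `d i` on `X (i + 1)`. -/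
noncomputable def foldDiff (F : FreeComplex k σ) : F.Total →ₗ[MvPolynomial σ k] F.Total :=
  DirectSum.toModule (MvPolynomial σ k) ℕ F.Total fun i =>
    match i with
    | 0 => 0
    | i + 1 => DirectSum.lof (MvPolynomial σ k) ℕ F.X i ∘ₗ F.d i

/-- `δ` is the differential of a degree `a` free flag anchored on the complex: it makes
`⨁ i, (X i)(i a)` a degree `a` differential module, it sends `X i` into the sum of the `X j` with
`j < i`, and its components `X (i + 1) → X i` are the differentials of the complex. -/
structure IsFreeFlag (F : FreeComplex k σ) (a : ℤ)
    (δ : F.Total →ₗ[MvPolynomial σ k] F.Total) : Prop where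
  isDifferentialModule : IsDifferentialModule (F.foldGrading a) a δ
  flag : ∀ (i j : ℕ) (x : F.X i), i ≤ j →
    (δ (DirectSum.lof (MvPolynomial σ k) ℕ F.X i x)) j = 0
  anchor : ∀ (i : ℕ) (x : F.X (i + 1)),
    (δ (DirectSum.lof (MvPolynomial σ k) ℕ F.X (i + 1) x)) i = F.d i x

/-- The complex is `a`-rigid: every degree `a` free flag anchored on it is isomorphic, as a graded
differential module, to its degree `a` fold. -/
def IsRigid (F : FreeComplex k σ) (a : ℤ) : Prop :=
  ∀ δ : F.Total →ₗ[MvPolynomial σ k] F.Total, F.IsFreeFlag a δ →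
    IsIsomorphic (F.foldGrading a) δ (F.foldGrading a) F.foldDiff

/-- The complex is a homogeneous free resolution of the graded module `M`, with augmentation
`ε : X 0 → M`. -/
structure IsResolution (F : FreeComplex k σ) {M : Type u} [AddCommGroup M]
    [Module (MvPolynomial σ k) M] (𝓜 : ℤ → AddSubgroup M)
    (ε : F.X 0 →ₗ[MvPolynomial σ k] M) : Prop where
  homogeneous : IsHomogeneousMap (F.gr 0) 𝓜 0 ε
  surjective : Function.Surjective ε
  exact_zero : Function.Exact (F.d 0) ε
  exact_succ : ∀ i, Function.Exact (F.d (i + 1)) (F.d i)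

end FreeComplex

/-- The graded module `M` is `a`-rigid: some homogeneous free resolution of `M` is `a`-rigid. -/
def IsRigidModule (k : Type u) [Field k] (σ : Type) {M : Type u} [AddCommGroup M]
    [Module (MvPolynomial σ k) M] (𝓜 : ℤ → AddSubgroup M) (a : ℤ) : Prop :=
  ∃ (F : FreeComplex k σ) (ε : F.X 0 →ₗ[MvPolynomial σ k] M),
    F.IsResolution 𝓜 ε ∧ F.IsRigid a

end DiffMod

/-! Let `K` be the Koszul complex on `f`. It resolves `S/I`, and its basis element `e_J` has degree
`d_J = ∑ i ∈ J, d i`.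

Rigidity. An isomorphism from the fold to a flag anchored on an exact complex is built one
homological degree at a time. The error in extending it to the next basis element is a cycle of the
flag lying lower in the filtration. Exactness allows boundaries to be subtracted from it until only
a component in `X 0` is left, and the class of that component in `H₀` is the obstruction. For `K`
the obstruction at `e_J`, `#J ≥ 2`, lies in degree `d_J - (#J - 1) a` of `S/I`. So `K` is rigid as
soon as `S/I` vanishes in all these degrees (`isRigid_of_forall_mem_range`, `complex_isRigid`).

Non-rigidity. For `i ≠ j` and a form `g` of degree `d i + d j - a`, contracting with `i` and `j` and
multiplying by `±g` gives a square-zero map `ψ` that anticommutes with the Koszul differential,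
hence a flag on `K`. Non-rigidity must be shown for every resolution `F`. Since `K` is minimal, it
is a homotopy retract of `F`, so `ψ` gives a flag on `F`. If that flag is isomorphic to the fold,
compressing the isomorphism and its inverse to `K` gives `α`, `β` with `α β ≡ 1` and `ψ β ≡ 0`
modulo `I`, because the differential of `K` vanishes modulo `I`. As `K` is finitely generated, also
`β α ≡ 1`, so `ψ ≡ 0` modulo `I`; evaluation on the wedge of two basis vectors gives `g ∈ I`
(`mem_smul_top_of_perturbation_equiv`, `mem_span_of_isRigid`).

Numerics. The Hilbert series of `S/I` is the product of the `1 + X + ⋯ + X ^ (d i - 1)`, so `S/I` is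
nonzero exactly in the degrees from `0` to the socle degree `∑ d i - n`. For `a` in the interval
some pair has `d i + d j - a` in this range (`exists_pair`); for `a` outside it no `J` with at least
two elements has `d_J - (#J - 1) a` in this range (`degree_lt_or_lt`). -/

namespace DiffMod

/-! ### Projections of graded groups. -/

section Projections

variable {M N : Type*} [AddCommGroup M] [AddCommGroup N] {𝓜 : ℤ → AddSubgroup M}
  {𝓝 : ℤ → AddSubgroup N}

/-- The projection to the piece of degree `m`. -/
noncomputable def proj (h : DirectSum.IsInternal 𝓜) (m : ℤ) : M →+ M :=
  ((𝓜 m).subtype.comp (DFinsupp.evalAddMonoidHom m)).comp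
    (AddEquiv.ofBijective (DirectSum.coeAddMonoidHom 𝓜) h).symm.toAddMonoidHom

theorem proj_mem (h : DirectSum.IsInternal 𝓜) (m : ℤ) (x : M) : proj h m x ∈ 𝓜 m :=
  Subtype.property _

theorem proj_of_mem (h : DirectSum.IsInternal 𝓜) {i : ℤ} (m : ℤ) {x : M} (hx : x ∈ 𝓜 i) :
    proj h m x = if i = m then x else 0 := by
  have : (AddEquiv.ofBijective (DirectSum.coeAddMonoidHom 𝓜) h).symm x =
      DirectSum.of (fun i => 𝓜 i) i ⟨x, hx⟩ := by
    rw [AddEquiv.symm_apply_eq]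
    exact (DirectSum.coeAddMonoidHom_of 𝓜 i ⟨x, hx⟩).symm
  change (((AddEquiv.ofBijective (DirectSum.coeAddMonoidHom 𝓜) h).symm x) m : M) = _
  rw [this]
  by_cases him : i = m
  · subst him
    simp
  · rw [if_neg him, DirectSum.of_eq_of_ne _ _ _ (Ne.symm him)]
    rfl

theorem proj_of_mem_same (h : DirectSum.IsInternal 𝓜) {m : ℤ} {x : M} (hx : x ∈ 𝓜 m) :
    proj h m x = x := by
  rw [proj_of_mem h m hx, if_pos rfl]

theorem grading_induction (h : DirectSum.IsInternal 𝓜) {P : M → Prop} (x : M) (h0 : P 0)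
    (hadd : ∀ x y, P x → P y → P (x + y)) (hmem : ∀ i, ∀ x ∈ 𝓜 i, P x) : P x := by
  obtain ⟨y, rfl⟩ := h.surjective x
  induction y using DirectSum.induction_on with
  | zero => simpa using h0
  | of i y => simpa using hmem i y y.2
  | add y z hy hz => simpa using hadd _ _ hy hz

/-- The maps `pr m` read off the components of a formal sum, which gives injectivity of the
summation map; `hsum` gives surjectivity. -/
theorem isInternal_of_proj (pr : ℤ → M →+ M) (hmem : ∀ m x, pr m x ∈ 𝓜 m)
    (hpr : ∀ i m x, x ∈ 𝓜 i → pr m x = if i = m then x else 0)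
    (hsum : ∀ x, ∃ T : Finset ℤ, x = ∑ m ∈ T, pr m x) : DirectSum.IsInternal 𝓜 := by
  constructor
  · rw [injective_iff_map_eq_zero]
    intro x hx
    have key : ∀ (y : ⨁ i, 𝓜 i) (m : ℤ), pr m (DirectSum.coeAddMonoidHom 𝓜 y) = y m := by
      intro y m
      induction y using DirectSum.induction_on with
      | zero => simp
      | of i y =>
        rw [DirectSum.coeAddMonoidHom_of, hpr i m _ y.2]
        by_cases him : i = m
        · subst him
          simp
        · rw [if_neg him, DirectSum.of_eq_of_ne _ _ _ (Ne.symm him)]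
          rfl
      | add y z hy hz => rw [map_add, map_add, hy, hz, DirectSum.add_apply]; rfl
    ext m
    rw [← key, hx, map_zero]
    rfl
  · intro x
    obtain ⟨T, hT⟩ := hsum x
    refine ⟨∑ m ∈ T, DirectSum.of (fun i => 𝓜 i) m ⟨pr m x, hmem m x⟩, ?_⟩
    rw [map_sum]
    conv_rhs => rw [hT]
    exact Finset.sum_congr rfl fun m _ => by simp

theorem proj_map (hM : DirectSum.IsInternal 𝓜) (hN : DirectSum.IsInternal 𝓝) (c : ℤ) (f : M →+ N)
    (hf : ∀ m, ∀ x ∈ 𝓜 m, f x ∈ 𝓝 (m + c)) (m : ℤ) (x : M) :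
    proj hN (m + c) (f x) = f (proj hM m x) := by
  induction x using grading_induction hM with
  | h0 => simp
  | hadd x y hx hy => simp only [map_add, hx, hy]
  | hmem i x hx =>
    rw [proj_of_mem hM m hx, proj_of_mem hN _ (hf i x hx)]
    by_cases him : i = m
    · simp [him]
    · simp [him]

/-- A homogeneous element in the image of a homogeneous map has a homogeneous preimage. -/
theorem exists_homogeneous_preimage (hM : DirectSum.IsInternal 𝓜) (hN : DirectSum.IsInternal 𝓝)
    (c : ℤ) (f : M →+ N) (hf : ∀ m, ∀ x ∈ 𝓜 m, f x ∈ 𝓝 (m + c)) {m : ℤ} {x : M}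
    (hx : f x ∈ 𝓝 (m + c)) : ∃ y ∈ 𝓜 m, f y = f x :=
  ⟨proj hM m x, proj_mem hM m x, by rw [← proj_map hM hN c f hf, proj_of_mem_same hN hx]⟩

end Projections

/-! ### The standard grading of the polynomial ring. -/

section Poly

variable {k : Type u} [Field k] {σ : Type}

theorem mem_polyGrading_iff {m : ℤ} {p : MvPolynomial σ k} :
    p ∈ polyGrading k σ m ↔ ∀ e : σ →₀ ℕ, p.coeff e ≠ 0 → (e.degree : ℤ) = m := Iff.rfl

theorem mem_polyGrading_natCast {t : ℕ} {p : MvPolynomial σ k} :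
    p ∈ polyGrading k σ t ↔ p.IsHomogeneous t := by
  have key : ∀ e : σ →₀ ℕ, Finsupp.weight (1 : σ → ℕ) e = e.degree := fun e =>
    (DFunLike.congr_fun (Finsupp.degree_eq_weight_one (σ := σ) (R := ℕ)) e).symm
  rw [mem_polyGrading_iff]
  constructor
  · intro h e he
    rw [key]
    exact_mod_cast h e he
  · intro h e he
    rw [← key]
    exact_mod_cast h he

theorem eq_zero_of_mem_polyGrading_of_neg {m : ℤ} (hm : m < 0) {p : MvPolynomial σ k}
    (hp : p ∈ polyGrading k σ m) : p = 0 := by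
  ext e
  by_contra he
  have := hp e he
  omega

theorem mul_mem_polyGrading {i j : ℤ} {p q : MvPolynomial σ k} (hp : p ∈ polyGrading k σ i)
    (hq : q ∈ polyGrading k σ j) : p * q ∈ polyGrading k σ (i + j) := by
  classical
  intro e he
  rw [MvPolynomial.coeff_mul] at he
  obtain ⟨x, hx, hx0⟩ := Finset.exists_ne_zero_of_sum_ne_zero he
  rw [Finset.HasAntidiagonal.mem_antidiagonal] at hx
  rw [← hp _ (left_ne_zero_of_mul hx0), ← hq _ (right_ne_zero_of_mul hx0), ← hx]
  simp

theorem C_mem_polyGrading (c : k) : MvPolynomial.C c ∈ polyGrading k σ 0 := by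
  have := (mem_polyGrading_natCast (t := 0)).2 (MvPolynomial.isHomogeneous_C σ c)
  exact_mod_cast this

theorem one_mem_polyGrading : (1 : MvPolynomial σ k) ∈ polyGrading k σ 0 := by
  simpa using C_mem_polyGrading (σ := σ) (1 : k)

/-- The homogeneous component of degree `m` of a polynomial. -/
noncomputable def polyProj (k : Type u) [Field k] (σ : Type) (m : ℤ) :
    MvPolynomial σ k →+ MvPolynomial σ k :=
  if 0 ≤ m then (MvPolynomial.homogeneousComponent m.toNat).toAddMonoidHom else 0

theorem polyProj_natCast (t : ℕ) (p : MvPolynomial σ k) :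
    polyProj k σ t p = MvPolynomial.homogeneousComponent t p := by
  simp [polyProj]

theorem isInternal_polyGrading : DirectSum.IsInternal (polyGrading k σ) := by
  refine isInternal_of_proj (polyProj k σ) ?_ ?_ ?_
  · intro m p
    by_cases hm : 0 ≤ m
    · lift m to ℕ using hm
      rw [polyProj_natCast, mem_polyGrading_natCast]
      exact MvPolynomial.homogeneousComponent_isHomogeneous _ _
    · rw [polyProj, if_neg hm]
      exact zero_mem _
  · intro i m p hp
    by_cases hi : 0 ≤ i
    · lift i to ℕ using hi
      rw [mem_polyGrading_natCast] at hp
      by_cases hm : 0 ≤ m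
      · lift m to ℕ using hm
        rw [polyProj_natCast, MvPolynomial.homogeneousComponent_of_mem hp]
        simp [eq_comm]
      · rw [polyProj, if_neg hm, if_neg (by omega)]
        rfl
    · simp [eq_zero_of_mem_polyGrading_of_neg (not_le.1 hi) hp]
  · intro p
    refine ⟨(Finset.range (p.totalDegree + 1)).map Nat.castEmbedding, ?_⟩
    rw [Finset.sum_map]
    conv_lhs => rw [← MvPolynomial.sum_homogeneousComponent p]
    exact Finset.sum_congr rfl fun t _ => (polyProj_natCast t p).symm

end Poly

/-! ### Homogeneous bases and graded lifting. -/

section Free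

variable {k : Type u} [Field k] {σ : Type}
  {M : Type u} [AddCommGroup M] [Module (MvPolynomial σ k) M] {𝓜 : ℤ → AddSubgroup M}
  {N : Type u} [AddCommGroup N] [Module (MvPolynomial σ k) N] {𝓝 : ℤ → AddSubgroup N}

theorem proj_smul (h : IsGrading (k := k) (σ := σ) 𝓜) {j m : ℤ} (p : MvPolynomial σ k) {x : M}
    (hx : x ∈ 𝓜 j) :
    proj h.isInternal m (p • x) = proj isInternal_polyGrading (m - j) p • x := by
  induction p using grading_induction isInternal_polyGrading with
  | h0 => simp
  | hadd p q hp hq => simp only [map_add, hp, hq, add_smul]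
  | hmem i p hp =>
    rw [proj_of_mem _ _ hp, proj_of_mem _ _ (h.smul_mem i j p x hp hx)]
    by_cases him : i + j = m
    · rw [if_pos him, if_pos (by omega)]
    · rw [if_neg him, if_neg (by omega), zero_smul]

/-- The coordinates of a homogeneous element in a homogeneous basis are homogeneous. -/
theorem repr_mem (h : IsGrading (k := k) (σ := σ) 𝓜) {ι : Type*} [Fintype ι]
    (b : Module.Basis ι (MvPolynomial σ k) M) (deg : ι → ℤ) (hb : ∀ j, b j ∈ 𝓜 (deg j)) {m : ℤ}
    {x : M} (hx : x ∈ 𝓜 m) (j : ι) : b.repr x j ∈ polyGrading k σ (m - deg j) := by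
  -- Projecting the basis expansion of `x` to degree `m` gives a second expansion of `x`;
  -- coordinates are unique, so each one equals its own homogeneous component.
  have h1 : x = ∑ j, proj isInternal_polyGrading (m - deg j) (b.repr x j) • b j := by
    conv_lhs => rw [← proj_of_mem_same h.isInternal hx, ← b.sum_repr x, map_sum]
    exact Finset.sum_congr rfl fun j _ => proj_smul h _ (hb j)
  have h2 := congrArg (fun y => b.repr y j) h1
  simp only [Module.Basis.repr_sum_self] at h2
  rw [h2]
  exact proj_mem _ _ _

theorem isHomogeneousMap_of_basis (h : IsGrading (k := k) (σ := σ) 𝓜)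
    (h' : IsGrading (k := k) (σ := σ) 𝓝) {ι : Type*} [Fintype ι]
    (b : Module.Basis ι (MvPolynomial σ k) M) (deg : ι → ℤ) (hb : ∀ j, b j ∈ 𝓜 (deg j)) {c : ℤ}
    (f : M →ₗ[MvPolynomial σ k] N) (hf : ∀ j, f (b j) ∈ 𝓝 (deg j + c)) :
    IsHomogeneousMap 𝓜 𝓝 c f := by
  intro m x hx
  rw [← b.sum_repr x, map_sum]
  refine sum_mem fun j _ => ?_
  rw [map_smul]
  have := h'.smul_mem _ _ _ _ (repr_mem h b deg hb hx j) (hf j)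
  rwa [show m - deg j + (deg j + c) = m + c by ring] at this

theorem IsHomogeneousMap.exists_preimage (h : DirectSum.IsInternal 𝓜)
    (h' : DirectSum.IsInternal 𝓝) {f : M →ₗ[MvPolynomial σ k] N}
    (hf : IsHomogeneousMap 𝓜 𝓝 0 f) {m : ℤ} {y : N} (hy : y ∈ 𝓝 m) (hr : y ∈ LinearMap.range f) :
    ∃ x ∈ 𝓜 m, f x = y := by
  obtain ⟨x, rfl⟩ := hr
  exact exists_homogeneous_preimage h h' 0 f.toAddMonoidHom (fun m x hx => hf m x hx)
    (by simpa using hy)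

/-- A homogeneous map from a graded free module lifts through a homogeneous map that covers its
values on a basis. -/
theorem exists_graded_lift {P : Type u} [AddCommGroup P] [Module (MvPolynomial σ k) P]
    {𝓟 : ℤ → AddSubgroup P} (hP : IsGradedFree k σ 𝓟) (hM : IsGrading (k := k) (σ := σ) 𝓜)
    (hN : DirectSum.IsInternal 𝓝)
    {f : M →ₗ[MvPolynomial σ k] N} (hf : IsHomogeneousMap 𝓜 𝓝 0 f)
    {g : P →ₗ[MvPolynomial σ k] N} (hg : IsHomogeneousMap 𝓟 𝓝 0 g)
    (hr : ∀ x, g x ∈ LinearMap.range f) :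
    ∃ l : P →ₗ[MvPolynomial σ k] M, IsHomogeneousMap 𝓟 𝓜 0 l ∧ f ∘ₗ l = g := by
  obtain ⟨hP, r, b, deg, hb⟩ := hP
  have : ∀ j, ∃ x ∈ 𝓜 (deg j + 0), f x = g (b j) := fun j =>
    hf.exists_preimage hM.isInternal hN (hg _ _ (hb j)) (hr _)
  choose x hx hx' using this
  refine ⟨b.constr ℕ x, isHomogeneousMap_of_basis hP hM b deg hb _ fun j => ?_, b.ext fun j => ?_⟩
  · rw [b.constr_basis]
    exact hx j
  · rw [LinearMap.comp_apply, b.constr_basis, hx']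

end Free

/-- Dependent choice: `P` is the invariant that allows the next step, `R` ties consecutive terms
together. All constructions along a resolution below go through it. -/
theorem exists_dependent_seq {α : ℕ → Type*} (P : ∀ p, α p → Prop) (R : ∀ p, α p → α (p + 1) → Prop)
    (a : α 0) (ha : P 0 a) (hs : ∀ p x, P p x → ∃ y, P (p + 1) y ∧ R p x y) :
    ∃ s : ∀ p, α p, s 0 = a ∧ (∀ p, P p (s p)) ∧ ∀ p, R p (s p) (s (p + 1)) := by
  choose f hf hf' using hs
  let t : ∀ p, {x : α p // P p x} := fun p =>
    Nat.rec (motive := fun p => {x : α p // P p x}) ⟨a, ha⟩ (fun p x => ⟨f p x.1 x.2, hf p _ _⟩) p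
  exact ⟨fun p => (t p).1, rfl, fun p => (t p).2, fun p => hf' p _ _⟩

theorem exists_lift_of_basis {R P M N ι : Type*} [CommRing R] [AddCommGroup P] [Module R P]
    [AddCommGroup M] [Module R M] [AddCommGroup N] [Module R N] (b : Module.Basis ι R P)
    (f : M →ₗ[R] N) (g : P →ₗ[R] N) (hr : ∀ x, g x ∈ LinearMap.range f) :
    ∃ l : P →ₗ[R] M, f ∘ₗ l = g := by
  choose x hx using fun j => hr (b j)
  exact ⟨b.constr ℕ x, b.ext fun j => by rw [LinearMap.comp_apply, b.constr_basis, hx]⟩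

namespace FreeComplex

variable {k : Type u} [Field k] {σ : Type}

theorem d_d (F : FreeComplex k σ) (i : ℕ) (x : F.X (i + 2)) : F.d i (F.d (i + 1) x) = 0 :=
  LinearMap.congr_fun (F.d_comp_d i) x

theorem isInternal (F : FreeComplex k σ) (i : ℕ) : DirectSum.IsInternal (F.gr i) :=
  (F.isGradedFree i).1.isInternal

/-! ### Comparison maps and homotopies of resolutions. -/

section Comparison

variable {M : Type u} [AddCommGroup M] [Module (MvPolynomial σ k) M] {𝓜 : ℤ → AddSubgroup M}

/-- Two resolutions of the same graded module are related by a homogeneous chain map. -/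
theorem exists_comparison {F G : FreeComplex k σ} {ε : F.X 0 →ₗ[MvPolynomial σ k] M}
    {ε' : G.X 0 →ₗ[MvPolynomial σ k] M} (hF : F.IsResolution 𝓜 ε) (hG : G.IsResolution 𝓜 ε')
    (hM : DirectSum.IsInternal 𝓜) :
    ∃ φ : ∀ p, F.X p →ₗ[MvPolynomial σ k] G.X p,
      (∀ p, IsHomogeneousMap (F.gr p) (G.gr p) 0 (φ p)) ∧
      (∀ p x, G.d p (φ (p + 1) x) = φ p (F.d p x)) ∧ ∀ x, ε' (φ 0 x) = ε x := by
  obtain ⟨φ₀, h₀, h₀'⟩ := exists_graded_lift (F.isGradedFree 0) (G.isGradedFree 0).1 hM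
    hG.homogeneous hF.homogeneous fun x => hG.surjective _
  have h₀'' : ∀ x, ε' (φ₀ x) = ε x := LinearMap.congr_fun h₀'
  -- Besides homogeneity, the invariant records that `φ ∘ d` lands in the boundaries of `G`, which
  -- is what makes the next lift possible.
  have hseq := exists_dependent_seq
    (α := fun p => F.X p →ₗ[MvPolynomial σ k] G.X p)
    (fun p φ => IsHomogeneousMap (F.gr p) (G.gr p) 0 φ ∧
      ∀ x, φ (F.d p x) ∈ LinearMap.range (G.d p))
    (fun p φ φ' => ∀ x, G.d p (φ' x) = φ (F.d p x)) φ₀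
    ⟨h₀, fun x => (hG.exact_zero _).1 (by rw [h₀'']; exact (hF.exact_zero _).2 ⟨x, rfl⟩)⟩
  specialize hseq ?_
  rotate_left
  · obtain ⟨φ, hφ0, hφ, hφ'⟩ := hseq
    exact ⟨φ, fun p => (hφ p).1, hφ', by rw [hφ0]; exact h₀''⟩
  · rintro p φ ⟨hφ, hr⟩
    obtain ⟨l, hl, hl'⟩ := exists_graded_lift (F.isGradedFree (p + 1)) (G.isGradedFree (p + 1)).1
      (G.isInternal p) (G.d_homogeneous p) (g := φ ∘ₗ F.d p)
      (fun m x hx => by simpa using hφ _ _ (F.d_homogeneous p m x hx)) hr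
    have hl'' : ∀ x, G.d p (l x) = φ (F.d p x) := LinearMap.congr_fun hl'
    refine ⟨l, ⟨hl, fun x => (hG.exact_succ p _).1 ?_⟩, hl''⟩
    rw [hl'', F.d_d, map_zero]

/-- A chain endomorphism of a resolution that is zero on homology is null-homotopic. -/
theorem exists_homotopy {F : FreeComplex k σ}
    (hF : ∀ i, Function.Exact (F.d (i + 1)) (F.d i))
    (v : ∀ p, F.X p →ₗ[MvPolynomial σ k] F.X p) (hv : ∀ p x, F.d p (v (p + 1) x) = v p (F.d p x))
    (hv0 : ∀ x, v 0 x ∈ LinearMap.range (F.d 0)) :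
    ∃ H : ∀ p, F.X p →ₗ[MvPolynomial σ k] F.X (p + 1), (∀ x, F.d 0 (H 0 x) = v 0 x) ∧
      ∀ p x, F.d (p + 1) (H (p + 1) x) + H p (F.d p x) = v (p + 1) x := by
  -- The homotopy is not asked to be homogeneous, so the degrees of the bases are discarded.
  have hb := fun p => (F.isGradedFree p).2
  choose r b deg _ using hb
  obtain ⟨H₀, h₀⟩ := exists_lift_of_basis (b 0) (F.d 0) (v 0) hv0
  have h₀' : ∀ x, F.d 0 (H₀ x) = v 0 x := LinearMap.congr_fun h₀
  have hseq := exists_dependent_seq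
    (α := fun p => F.X p →ₗ[MvPolynomial σ k] F.X (p + 1))
    (fun p H => ∀ x, v (p + 1) x - H (F.d p x) ∈ LinearMap.range (F.d (p + 1)))
    (fun p H H' => ∀ x, F.d (p + 1) (H' x) + H (F.d p x) = v (p + 1) x) H₀
    (fun x => (hF 0 _).1 (by rw [map_sub, hv, h₀', sub_self]))
  specialize hseq ?_
  rotate_left
  · obtain ⟨H, hH0, -, hH'⟩ := hseq
    exact ⟨H, by rw [hH0]; exact h₀', hH'⟩
  · intro p H hH
    obtain ⟨l, hl⟩ := exists_lift_of_basis (b (p + 1)) (F.d (p + 1)) (v (p + 1) - H ∘ₗ F.d p) hH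
    have hl' : ∀ x, F.d (p + 1) (l x) = v (p + 1) x - H (F.d p x) := LinearMap.congr_fun hl
    refine ⟨l, fun x => (hF (p + 1) _).1 ?_, fun x => by rw [hl', sub_add_cancel]⟩
    rw [map_sub, hv, hl', F.d_d, map_zero, sub_zero, sub_self]

end Comparison

/-! ### The total module and its filtration by homological degree. -/

section Total

variable (F : FreeComplex k σ)

/-- The inclusion of the term `X i` in the total module. -/
noncomputable abbrev inc (i : ℕ) : F.X i →ₗ[MvPolynomial σ k] F.Total :=
  DirectSum.lof (MvPolynomial σ k) ℕ F.X i

theorem inc_apply_same (i : ℕ) (x : F.X i) : (F.inc i x) i = x := DirectSum.lof_apply _ i x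

theorem inc_apply_ne {i j : ℕ} (h : j ≠ i) (x : F.X i) : (F.inc i x) j = 0 :=
  DirectSum.of_eq_of_ne _ _ _ h

theorem exists_eq_sum_inc (x : F.Total) : ∃ s : Finset ℕ, x = ∑ i ∈ s, F.inc i (x i) := by
  classical
  exact ⟨DFinsupp.support x, (DirectSum.sum_support_of x).symm⟩

theorem inc_mem_foldGrading {a m : ℤ} {i : ℕ} {x : F.X i} (hx : x ∈ F.gr i (m + i * a)) :
    F.inc i x ∈ F.foldGrading a m := by
  intro j
  by_cases h : j = i
  · subst h
    rwa [inc_apply_same]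
  · rw [F.inc_apply_ne h]
    exact zero_mem _

theorem map_mem_of_mem_foldGrading {N : Type*} [AddCommGroup N] [Module (MvPolynomial σ k) N]
    {a m : ℤ} {A : AddSubgroup N} (f : F.Total →ₗ[MvPolynomial σ k] N)
    (hf : ∀ i, ∀ x ∈ F.gr i (m + i * a), f (F.inc i x) ∈ A) {x : F.Total}
    (hx : x ∈ F.foldGrading a m) : f x ∈ A := by
  obtain ⟨s, hs⟩ := F.exists_eq_sum_inc x
  rw [hs, map_sum]
  exact sum_mem fun i _ => hf i _ (hx i)

theorem foldDiff_inc_zero (x : F.X 0) : F.foldDiff (F.inc 0 x) = 0 := by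
  simp [foldDiff, inc]

theorem foldDiff_inc_succ (i : ℕ) (x : F.X (i + 1)) :
    F.foldDiff (F.inc (i + 1) x) = F.inc i (F.d i x) := by
  simp [foldDiff, inc]

/-- The elements of the total module with components in degrees less than `p` only. -/
def fil (p : ℕ) : Submodule (MvPolynomial σ k) F.Total where
  carrier := {x | ∀ i, p ≤ i → x i = 0}
  zero_mem' := fun _ _ => rfl
  add_mem' := fun {x y} hx hy i hi => by rw [DirectSum.add_apply, hx i hi, hy i hi, add_zero]
  smul_mem' := fun c x hx i hi => by
    change c • x i = 0
    rw [hx i hi, smul_zero]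

theorem fil_mono {p q : ℕ} (h : p ≤ q) : F.fil p ≤ F.fil q := fun _ hx i hi => hx i (h.trans hi)

theorem inc_mem_fil {i p : ℕ} (h : i < p) (x : F.X i) : F.inc i x ∈ F.fil p := fun j hj =>
  F.inc_apply_ne (by omega) x

theorem eq_zero_of_mem_fil_zero {x : F.Total} (hx : x ∈ F.fil 0) : x = 0 :=
  DFinsupp.ext fun i => hx i (Nat.zero_le i)

theorem sub_inc_mem_fil {p : ℕ} {x : F.Total} (hx : x ∈ F.fil (p + 1)) :
    x - F.inc p (x p) ∈ F.fil p := by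
  intro i hi
  rw [DirectSum.sub_apply]
  by_cases h : i = p
  · subst h
    rw [inc_apply_same, sub_self]
  · rw [F.inc_apply_ne h, hx i (by omega), sub_zero]

theorem exists_mem_fil (x : F.Total) : ∃ p, x ∈ F.fil p := by
  obtain ⟨s, hs⟩ := F.exists_eq_sum_inc x
  refine ⟨s.sup id + 1, hs ▸ sum_mem fun i hi => F.inc_mem_fil ?_ _⟩
  exact Nat.lt_succ_of_le (Finset.le_sup (f := id) hi)

/-- An endomorphism of the total module that is unipotent for the filtration is bijective. -/
theorem bijective_of_unipotent {φ : F.Total →ₗ[MvPolynomial σ k] F.Total}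
    (hφ : ∀ p x, φ (F.inc p x) - F.inc p x ∈ F.fil p) : Function.Bijective φ := by
  have key : ∀ p x, x ∈ F.fil (p + 1) → φ x - x ∈ F.fil p := by
    intro p
    induction p with
    | zero =>
      intro x hx
      have := F.eq_zero_of_mem_fil_zero (F.sub_inc_mem_fil hx)
      rw [sub_eq_zero.1 this]
      exact hφ 0 _
    | succ p ih =>
      intro x hx
      have h1 := ih _ (F.sub_inc_mem_fil hx)
      have h2 := add_mem (F.fil_mono (Nat.le_succ p) h1) (hφ (p + 1) (x (p + 1)))
      rw [map_sub] at h2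
      convert h2 using 1
      abel
  constructor
  · rw [injective_iff_map_eq_zero]
    intro x hx
    obtain ⟨p, hp⟩ := F.exists_mem_fil x
    induction p with
    | zero => exact F.eq_zero_of_mem_fil_zero hp
    | succ p ih =>
      refine ih ?_
      have := key p x hp
      rw [hx, zero_sub] at this
      exact neg_mem_iff.1 this
  · intro x
    obtain ⟨p, hp⟩ := F.exists_mem_fil x
    induction p generalizing x with
    | zero => exact ⟨0, by rw [F.eq_zero_of_mem_fil_zero hp, map_zero]⟩
    | succ p ih =>
      obtain ⟨y, hy⟩ := ih _ (key p x hp)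
      exact ⟨x - y, by rw [map_sub, hy, sub_sub_cancel]⟩

/-- The top components of `x` and `φ x` agree, so the top component of `x` is homogeneous; removing
it lowers the filtration. This makes the inverse of `φ` homogeneous. -/
theorem mem_foldGrading_of_unipotent {a : ℤ} {φ : F.Total →ₗ[MvPolynomial σ k] F.Total}
    (hφ : ∀ p x, φ (F.inc p x) - F.inc p x ∈ F.fil p) {m : ℤ}
    (hh : ∀ x ∈ F.foldGrading a m, φ x ∈ F.foldGrading a m) {x : F.Total}
    (hx : φ x ∈ F.foldGrading a m) : x ∈ F.foldGrading a m := by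
  obtain ⟨p, hp⟩ := F.exists_mem_fil x
  have hle : ∀ q y, y ∈ F.fil q → φ y ∈ F.fil q := by
    intro q
    induction q with
    | zero =>
      intro y hy
      rw [F.eq_zero_of_mem_fil_zero hy, map_zero]
      exact zero_mem _
    | succ q ih =>
      intro y hy
      have h1 := F.fil_mono (Nat.le_succ q) (ih _ (F.sub_inc_mem_fil hy))
      have h2 := F.fil_mono (Nat.le_succ q) (hφ q (y q))
      have h3 := add_mem (add_mem h1 h2) (F.inc_mem_fil (Nat.lt_succ_self q) (y q))
      rw [map_sub] at h3
      convert h3 using 1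
      abel
  induction p generalizing x with
  | zero =>
    rw [F.eq_zero_of_mem_fil_zero hp]
    exact zero_mem _
  | succ p ih =>
    have hcomp : (φ x) p = x p := by
      have h1 := hle _ _ (F.sub_inc_mem_fil hp) p le_rfl
      have h2 := hφ p (x p) p le_rfl
      rw [map_sub, DirectSum.sub_apply, sub_eq_zero] at h1
      rw [DirectSum.sub_apply, sub_eq_zero, inc_apply_same] at h2
      rw [h1, h2]
    have h1 : F.inc p (x p) ∈ F.foldGrading a m := F.inc_mem_foldGrading (hcomp ▸ hx p)
    have h2 := ih (x := x - F.inc p (x p))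
      (by rw [map_sub]; exact sub_mem hx (hh _ h1)) (F.sub_inc_mem_fil hp)
    simpa using add_mem h2 h1

end Total

/-! ### Obstruction theory for free flags. -/

section Flag

variable {F : FreeComplex k σ} {a : ℤ} {δ : F.Total →ₗ[MvPolynomial σ k] F.Total}

theorem IsFreeFlag.map_fil (h : F.IsFreeFlag a δ) {p q : ℕ} (hpq : p ≤ q + 1) {x : F.Total}
    (hx : x ∈ F.fil p) : δ x ∈ F.fil q := by
  induction p generalizing x with
  | zero =>
    rw [F.eq_zero_of_mem_fil_zero hx, map_zero]
    exact zero_mem _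
  | succ p ih =>
    have h1 := ih (by omega) (F.sub_inc_mem_fil hx)
    have h2 : δ (F.inc p (x p)) ∈ F.fil q := fun j hj => h.flag p j (x p) (by omega)
    have h3 := add_mem h1 h2
    rwa [map_sub, sub_add_cancel] at h3

theorem IsFreeFlag.apply_top (h : F.IsFreeFlag a δ) {p : ℕ} {x : F.Total}
    (hx : x ∈ F.fil (p + 2)) : (δ x) p = F.d p (x (p + 1)) := by
  have h1 := h.map_fil le_rfl (F.sub_inc_mem_fil hx) p le_rfl
  rw [map_sub, DirectSum.sub_apply, sub_eq_zero] at h1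
  rw [h1, h.anchor]

/-- A homogeneous cycle of a free flag anchored on an exact complex is, up to a boundary,
concentrated in `X 0`. -/
theorem IsFreeFlag.exists_sub_mem_fil_one (h : F.IsFreeFlag a δ)
    (hF : ∀ i, Function.Exact (F.d (i + 1)) (F.d i)) {m : ℤ} (p : ℕ) {z : F.Total}
    (hz : z ∈ F.fil (p + 1)) (hzm : z ∈ F.foldGrading a m) (hδ : δ z = 0) :
    ∃ w ∈ F.fil (p + 2), w ∈ F.foldGrading a (m - a) ∧ z - δ w ∈ F.fil 1 := by
  induction p generalizing z with
  | zero => exact ⟨0, zero_mem _, zero_mem _, by simpa using hz⟩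
  | succ p ih =>
    have h1 : F.d p (z (p + 1)) = 0 := by
      rw [← h.apply_top hz, hδ]
      rfl
    -- The top component of a cycle of the flag is a cycle of the complex; a homogeneous preimage
    -- `y` of it in `X (p + 2)` kills it, and the induction continues one step lower.
    obtain ⟨y, hy, hyz⟩ := (F.d_homogeneous (p + 1)).exists_preimage (F.isInternal (p + 2))
      (F.isInternal (p + 1)) (hzm (p + 1)) ((hF p _).1 h1)
    have hy1 : F.inc (p + 2) y ∈ F.fil (p + 3) := F.inc_mem_fil (by omega) y
    have hy2 : F.inc (p + 2) y ∈ F.foldGrading a (m - a) := by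
      refine F.inc_mem_foldGrading ?_
      convert hy using 2
      push_cast
      ring
    have hy3 : δ (F.inc (p + 2) y) ∈ F.foldGrading a m := by
      simpa using h.isDifferentialModule.homogeneous _ _ hy2
    have hy4 : z - δ (F.inc (p + 2) y) ∈ F.fil (p + 1) := by
      intro i hi
      rw [DirectSum.sub_apply]
      rcases hi.eq_or_lt with rfl | hi
      · rw [h.anchor, hyz, sub_self]
      · rw [hz i (by omega), h.flag _ _ _ (by omega), sub_zero]
    obtain ⟨w, hw1, hw2, hw3⟩ := ih hy4 (sub_mem hzm hy3) (by
      rw [map_sub, hδ, zero_sub, neg_eq_zero]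
      exact LinearMap.congr_fun h.isDifferentialModule.sq_zero _)
    refine ⟨w + F.inc (p + 2) y, add_mem (F.fil_mono (by omega) hw1) hy1, add_mem hw2 hy2, ?_⟩
    rw [map_add]
    convert hw3 using 1
    abel

/-- The vanishing of the obstructions: an exact complex is rigid if for `p ≥ 2` the forms of `X 0`
whose degree is `(p - 1) a` less than that of a basis element of `X p` are boundaries. -/
theorem isRigid_of_forall_mem_range (F : FreeComplex k σ) (a : ℤ)
    (hF : ∀ i, Function.Exact (F.d (i + 1)) (F.d i)) {ι : ℕ → Type*} [∀ p, Fintype (ι p)]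
    (b : ∀ p, Module.Basis (ι p) (MvPolynomial σ k) (F.X p)) (deg : ∀ p, ι p → ℤ)
    (hb : ∀ p j, b p j ∈ F.gr p (deg p j))
    (hobs : ∀ p j, ∀ z ∈ F.gr 0 (deg (p + 2) j - (p + 1) * a), z ∈ LinearMap.range (F.d 0)) :
    F.IsRigid a := by
  intro δ h
  have hsq : ∀ x, δ (δ x) = 0 := LinearMap.congr_fun h.isDifferentialModule.sq_zero
  -- The restriction `φ` to `X p` of an isomorphism from the fold to the flag: it is the inclusion
  -- up to lower filtration, it is homogeneous, and it sends boundaries of the complex to cycles of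
  -- the flag.
  have hseq := exists_dependent_seq
    (α := fun p => F.X p →ₗ[MvPolynomial σ k] F.Total)
    (fun p φ => (∀ x, φ x - F.inc p x ∈ F.fil p) ∧
      (∀ m, ∀ x ∈ F.gr p (m + p * a), φ x ∈ F.foldGrading a m) ∧ ∀ x, δ (φ (F.d p x)) = 0)
    (fun p φ φ' => ∀ x, δ (φ' x) = φ (F.d p x)) (F.inc 0)
    ⟨fun x => by rw [sub_self]; exact zero_mem _, fun m x hx => F.inc_mem_foldGrading hx,
      fun x => F.eq_zero_of_mem_fil_zero (h.map_fil le_rfl (F.inc_mem_fil Nat.zero_lt_one _))⟩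
  specialize hseq ?_
  rotate_left
  · obtain ⟨φ, hφ0, hφ, hφ'⟩ := hseq
    let Φ : F.Total →ₗ[MvPolynomial σ k] F.Total := DirectSum.toModule _ ℕ F.Total φ
    have hΦ : ∀ p x, Φ (F.inc p x) = φ p x := fun p x => DirectSum.toModule_lof _ _ _
    have huni : ∀ p x, Φ (F.inc p x) - F.inc p x ∈ F.fil p := fun p x => by
      rw [hΦ]
      exact (hφ p).1 x
    have hhom : ∀ m, ∀ x ∈ F.foldGrading a m, Φ x ∈ F.foldGrading a m := fun m x hx =>
      F.map_mem_of_mem_foldGrading Φ (fun i y hy => by rw [hΦ]; exact (hφ i).2.1 m y hy) hx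
    have hcomm : δ ∘ₗ Φ = Φ ∘ₗ F.foldDiff := by
      refine DirectSum.linearMap_ext _ fun p => LinearMap.ext fun x => ?_
      change δ (Φ (F.inc p x)) = Φ (F.foldDiff (F.inc p x))
      cases p with
      | zero =>
        rw [F.foldDiff_inc_zero, map_zero, hΦ, hφ0]
        exact F.eq_zero_of_mem_fil_zero (h.map_fil le_rfl (F.inc_mem_fil Nat.zero_lt_one _))
      | succ p => rw [F.foldDiff_inc_succ, hΦ, hΦ, hφ']
    -- `Φ` maps the fold to the flag, so its inverse is the isomorphism asked for.
    let e := LinearEquiv.ofBijective Φ (F.bijective_of_unipotent huni)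
    refine ⟨e.symm, fun m x => ?_, fun x => ?_⟩
    · obtain ⟨y, rfl⟩ := e.surjective x
      rw [LinearEquiv.symm_apply_apply]
      exact ⟨F.mem_foldGrading_of_unipotent huni (hhom m), hhom m y⟩
    · obtain ⟨y, rfl⟩ := e.surjective x
      rw [LinearEquiv.symm_apply_apply, LinearEquiv.symm_apply_eq]
      exact LinearMap.congr_fun hcomm y
  · rintro p φ ⟨h1, h2, h3⟩
    -- With such a `y`, the element `inc (p + 1) e - y` is sent by `δ` to `φ (d e)`, as the next
    -- value of `φ` must be.
    have key : ∀ j, ∃ y ∈ F.fil (p + 1), y ∈ F.foldGrading a (deg (p + 1) j - (p + 1) * a) ∧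
        δ y = δ (F.inc (p + 1) (b (p + 1) j)) - φ (F.d p (b (p + 1) j)) := by
      intro j
      set e := b (p + 1) j with he
      set m := deg (p + 1) j - p * a with hm
      set z := δ (F.inc (p + 1) e) - φ (F.d p e) with hz
      have hdeg : (F.inc (p + 1) e) ∈ F.foldGrading a (m - a) := by
        refine F.inc_mem_foldGrading ?_
        convert hb (p + 1) j using 2
        push_cast
        ring
      have hzm : z ∈ F.foldGrading a m := by
        refine sub_mem ?_ (h2 m _ ?_)
        · simpa using h.isDifferentialModule.homogeneous _ _ hdeg
        · convert F.d_homogeneous p _ _ (hb (p + 1) j) using 2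
          rw [hm]
          ring
      have hz0 : δ z = 0 := by rw [hz, map_sub, hsq, h3, sub_zero]
      -- Both terms of `z` have leading part `inc p (d e)`, so it cancels.
      have hzf : z ∈ F.fil p := by
        have hz1 : δ (F.inc (p + 1) e) - F.inc p (F.d p e) ∈ F.fil p := by
          have := F.sub_inc_mem_fil (h.map_fil le_rfl (F.inc_mem_fil (Nat.lt_succ_self (p + 1)) e))
          rwa [h.anchor] at this
        have := sub_mem hz1 (h1 (F.d p e))
        rwa [sub_sub_sub_cancel_right] at this
      have hma : deg (p + 1) j - (p + 1) * a = m - a := by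
        rw [hm]
        ring
      rw [hma]
      cases p with
      | zero => exact ⟨0, zero_mem _, zero_mem _, by
          rw [map_zero, F.eq_zero_of_mem_fil_zero hzf]⟩
      | succ q =>
        -- Up to the boundary `δ w`, the error `z` sits in `X 0`, in degree `m`. There `hobs` makes
        -- it a boundary `d v`, and `w + inc 1 v` is the correction.
        obtain ⟨w, hw1, hw2, hw3⟩ := h.exists_sub_mem_fil_one hF q hzf hzm hz0
        have hw4 : z - δ w ∈ F.foldGrading a m :=
          sub_mem hzm (by simpa using h.isDifferentialModule.homogeneous _ _ hw2)
        have hw5 := sub_eq_zero.1 (F.eq_zero_of_mem_fil_zero (F.sub_inc_mem_fil hw3))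
        have hw6 := hw4 0
        obtain ⟨v, hv, hv'⟩ := (F.d_homogeneous 0).exists_preimage (F.isInternal 1)
          (F.isInternal 0) hw6 (hobs q j _ (by
            convert hw6 using 2
            rw [hm]
            push_cast
            ring))
        have hv1 : δ (F.inc 1 v) = F.inc 0 (F.d 0 v) := by
          have := F.eq_zero_of_mem_fil_zero (F.sub_inc_mem_fil
            (h.map_fil le_rfl (F.inc_mem_fil Nat.one_lt_two v)))
          rw [h.anchor] at this
          exact sub_eq_zero.1 this
        refine ⟨w + F.inc 1 v, add_mem hw1 (F.inc_mem_fil (by omega) v),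
          add_mem hw2 (F.inc_mem_foldGrading ?_), ?_⟩
        · convert hv using 2
          push_cast
          ring
        · rw [map_add, hv1, hv', ← hw5]
          abel
    choose y hy1 hy2 hy3 using key
    let θ : F.X (p + 1) →ₗ[MvPolynomial σ k] F.Total := (b (p + 1)).constr ℕ y
    have hθ : ∀ j, θ (b (p + 1) j) = y j := fun j => (b (p + 1)).constr_basis ℕ y j
    have hR : ∀ x, δ ((F.inc (p + 1) - θ) x) = φ (F.d p x) := by
      refine LinearMap.congr_fun (f := δ ∘ₗ (F.inc (p + 1) - θ)) (g := φ ∘ₗ F.d p)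
        ((b (p + 1)).ext fun j => ?_)
      change δ (F.inc (p + 1) (b (p + 1) j) - θ (b (p + 1) j)) = φ (F.d p (b (p + 1) j))
      rw [hθ, map_sub, hy3, sub_sub_cancel]
    refine ⟨F.inc (p + 1) - θ, ⟨fun x => ?_, fun m x hx => ?_, fun x => ?_⟩, hR⟩
    · rw [LinearMap.sub_apply, sub_sub_cancel_left, neg_mem_iff, ← (b (p + 1)).sum_repr x, map_sum]
      refine sum_mem fun j _ => ?_
      rw [map_smul, hθ]
      exact Submodule.smul_mem _ _ (hy1 j)
    · rw [LinearMap.sub_apply]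
      refine sub_mem (F.inc_mem_foldGrading hx) ?_
      rw [← (b (p + 1)).sum_repr x, map_sum]
      refine sum_mem fun j _ => ?_
      rw [map_smul, hθ]
      intro i
      change (b (p + 1)).repr x j • (y j) i ∈ F.gr i (m + i * a)
      have := (F.isGradedFree i).1.smul_mem _ _ _ _
        (repr_mem (F.isGradedFree (p + 1)).1 (b (p + 1)) (deg (p + 1)) (hb (p + 1)) hx j) (hy2 j i)
      convert this using 2
      push_cast
      ring
    · rw [hR, F.d_d, map_zero]

end Flag

end FreeComplex

/-! ### Perturbing a differential along a homotopy retract. -/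

section Perturbation

variable {R T U : Type*} [CommRing R] [AddCommGroup T] [Module R T] [AddCommGroup U] [Module R U]

theorem map_mem_smul_top (I : Ideal R) (f : T →ₗ[R] U) {x : T}
    (hx : x ∈ I • (⊤ : Submodule R T)) : f x ∈ I • (⊤ : Submodule R U) := by
  have := Submodule.mem_map_of_mem (f := f) hx
  rw [Submodule.map_smul''] at this
  exact Submodule.smul_mono le_rfl le_top this

/-- Over a commutative ring, one-sided inverses modulo an ideal of endomorphisms of a finite module
are two-sided. -/
theorem comp_sub_mem_smul_top_comm [Module.Finite R T] (I : Ideal R) (f g : T →ₗ[R] T)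
    (h : ∀ x, f (g x) - x ∈ I • (⊤ : Submodule R T)) (x : T) :
    g (f x) - x ∈ I • (⊤ : Submodule R T) := by
  let A : Submodule R T := I • ⊤
  let f' : T ⧸ A →ₗ[R] T ⧸ A := A.mapQ A f fun y hy => map_mem_smul_top I f hy
  have hsurj : Function.Surjective f' := by
    intro y
    obtain ⟨y, rfl⟩ := A.mkQ_surjective y
    exact ⟨A.mkQ (g y), (Submodule.Quotient.eq A).2 (h y)⟩
  have hinj := OrzechProperty.injective_of_surjective_endomorphism f' hsurj
  refine (Submodule.Quotient.eq A).1 (hinj ?_)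
  exact (Submodule.Quotient.eq A).2 (h (f x))

/-- If a differential module `U` retracts onto the finite free part `T` up to homotopy, and the
perturbation of the differential of `U` by an endomorphism `ψ` of `T` gives an isomorphic
differential module, then `ψ` vanishes modulo every ideal modulo which the differential of `T`
vanishes. -/
theorem mem_smul_top_of_perturbation_equiv [Module.Finite R T] (I : Ideal R) (dT ψ : T →ₗ[R] T)
    (dU H : U →ₗ[R] U) (i : T →ₗ[R] U) (p : U →ₗ[R] T) (e : U ≃ₗ[R] U)
    (hi : ∀ x, dU (i x) = i (dT x)) (hp : ∀ x, p (dU x) = dT (p x)) (hpi : ∀ x, p (i x) = x)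
    (hH : ∀ x, dU (H x) + H (dU x) = x - i (p x))
    (he : ∀ x, e (dU x + i (ψ (p x))) = dU (e x))
    (hI : ∀ x, dT x ∈ I • (⊤ : Submodule R T)) (x : T) : ψ x ∈ I • (⊤ : Submodule R T) := by
  let q : U →ₗ[R] U := LinearMap.id - i ∘ₗ p
  have hq : ∀ x, q x = x - i (p x) := fun _ => rfl
  -- Sandwiching the homotopy between the complementary projections `q` secures `G i = 0` and `p G =
  -- 0`. These two identities remove the terms in `ψ` from the computation of `α β` below.
  let G : U →ₗ[R] U := q ∘ₗ H ∘ₗ q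
  have hG : ∀ x, G x = q (H (q x)) := fun _ => rfl
  have hqi : ∀ x, q (i x) = 0 := fun x => by rw [hq, hpi, sub_self]
  have hpq : ∀ x, p (q x) = 0 := fun x => by rw [hq, map_sub, hpi, sub_self]
  have hqq : ∀ x, q (q x) = q x := fun x => by
    rw [hq (q x), hpq, map_zero, sub_zero]
  have hqd : ∀ x, q (dU x) = dU (q x) := fun x => by rw [hq, hq, map_sub, hi, hp]
  have hGd : ∀ x, dU (G x) + G (dU x) = q x := by
    intro x
    rw [hG, hG, hqd, ← hqd (H _), ← map_add, hH, ← hq, hqq, hqq]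
  have hGi : ∀ x, G (i x) = 0 := fun x => by rw [hG, hqi, map_zero, map_zero]
  have hpG : ∀ x, p (G x) = 0 := fun x => hpq _
  have he' : ∀ x, e (dU x) = dU (e x) - e (i (ψ (p x))) := fun x => by
    rw [← he, map_add, add_sub_cancel_right]
  have hes : ∀ x, e.symm (dU x) = dU (e.symm x) + i (ψ (p (e.symm x))) := fun x => by
    rw [LinearEquiv.symm_apply_eq, he, LinearEquiv.apply_symm_apply]
  let α : T →ₗ[R] T := p ∘ₗ e.toLinearMap ∘ₗ i
  let β : T →ₗ[R] T := p ∘ₗ e.symm.toLinearMap ∘ₗ i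
  let Y : T →ₗ[R] T := p ∘ₗ e.toLinearMap ∘ₗ G ∘ₗ e.symm.toLinearMap ∘ₗ i
  have hα : ∀ x, α x = p (e (i x)) := fun _ => rfl
  have hβ : ∀ x, β x = p (e.symm (i x)) := fun _ => rfl
  have hY : ∀ x, Y x = p (e (G (e.symm (i x)))) := fun _ => rfl
  -- Insert `i p = 1 - (dU G + G dU)` between `e` and `e.symm`: the identity contributes `x`, the
  -- homotopy contributes terms containing `dT`.
  have hαβ : ∀ x, α (β x) - x = -(dT (Y x) + Y (dT x)) := by
    intro x
    have h1 : i (p (e.symm (i x))) =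
        e.symm (i x) - (dU (G (e.symm (i x))) + G (dU (e.symm (i x)))) := by
      rw [hGd, hq, sub_sub_cancel]
    have h2 : Y (dT x) = p (e (G (dU (e.symm (i x))))) := by
      rw [hY, ← hi, hes, map_add, hGi, add_zero]
    have h3 : dT (Y x) = p (e (dU (G (e.symm (i x))))) := by
      rw [hY, ← hp, he', hpG, map_zero, map_zero, map_zero, sub_zero]
    rw [hα, hβ, h1, h2, h3]
    simp only [map_sub, map_add, LinearEquiv.apply_symm_apply, hpi]
    abel
  have hβψ : ∀ x, ψ (β x) ∈ I • (⊤ : Submodule R T) := by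
    intro x
    have h1 : ψ (β x) = β (dT x) - dT (β x) := by
      rw [hβ, hβ, ← hi, hes, map_add, hp, hpi, add_sub_cancel_left]
    rw [h1]
    exact sub_mem (map_mem_smul_top I β (hI x)) (hI _)
  -- Finiteness of `T` turns `α β ≡ 1` into `β α ≡ 1`, whence `ψ ≡ ψ β α ≡ 0` modulo `I`.
  have hβα := comp_sub_mem_smul_top_comm I α β (fun x => by
    rw [hαβ]
    exact neg_mem (add_mem (hI _) (map_mem_smul_top I Y (hI x)))) x
  have := sub_mem (hβψ (α x)) (map_mem_smul_top I ψ hβα)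
  rwa [map_sub, sub_sub_cancel] at this

end Perturbation

/-! ### Flags obtained by adding a map of homological degree `-2`. -/

namespace FreeComplex

variable {k : Type u} [Field k] {σ : Type}

theorem linearMap_ext_inc (F : FreeComplex k σ) {N : Type*} [AddCommGroup N]
    [Module (MvPolynomial σ k) N] {f g : F.Total →ₗ[MvPolynomial σ k] N}
    (h : ∀ i x, f (F.inc i x) = g (F.inc i x)) (x : F.Total) : f x = g x :=
  LinearMap.congr_fun (DirectSum.linearMap_ext _ fun i => LinearMap.ext (h i)) x

theorem foldDiff_foldDiff (F : FreeComplex k σ) (x : F.Total) : F.foldDiff (F.foldDiff x) = 0 := by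
  refine F.linearMap_ext_inc (f := F.foldDiff ∘ₗ F.foldDiff) (g := 0) (fun i y => ?_) x
  change F.foldDiff (F.foldDiff (F.inc i y)) = 0
  match i with
  | 0 => rw [foldDiff_inc_zero, map_zero]
  | 1 => rw [foldDiff_inc_succ, foldDiff_inc_zero]
  | i + 2 => rw [foldDiff_inc_succ, foldDiff_inc_succ, d_d, map_zero]

theorem foldDiff_inc_mem_foldGrading (F : FreeComplex k σ) {a m : ℤ} (i : ℕ) {x : F.X i}
    (hx : x ∈ F.gr i (m + i * a)) : F.foldDiff (F.inc i x) ∈ F.foldGrading a (m + a) := by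
  cases i with
  | zero =>
    rw [foldDiff_inc_zero]
    exact zero_mem _
  | succ i =>
    rw [foldDiff_inc_succ]
    refine F.inc_mem_foldGrading ?_
    convert F.d_homogeneous i _ _ hx using 2
    push_cast
    ring

/-- The map of total modules induced by a family of maps that preserves the homological degree. -/
noncomputable def totalMap {F G : FreeComplex k σ} (φ : ∀ p, F.X p →ₗ[MvPolynomial σ k] G.X p) :
    F.Total →ₗ[MvPolynomial σ k] G.Total :=
  DirectSum.toModule _ ℕ _ fun p => G.inc p ∘ₗ φ p

theorem totalMap_inc {F G : FreeComplex k σ} (φ : ∀ p, F.X p →ₗ[MvPolynomial σ k] G.X p) (p : ℕ)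
    (x : F.X p) : totalMap φ (F.inc p x) = G.inc p (φ p x) :=
  DirectSum.toModule_lof _ _ _

theorem foldDiff_totalMap {F G : FreeComplex k σ} {φ : ∀ p, F.X p →ₗ[MvPolynomial σ k] G.X p}
    (hφ : ∀ p x, G.d p (φ (p + 1) x) = φ p (F.d p x)) (x : F.Total) :
    G.foldDiff (totalMap φ x) = totalMap φ (F.foldDiff x) := by
  refine F.linearMap_ext_inc (f := G.foldDiff ∘ₗ totalMap φ) (g := totalMap φ ∘ₗ F.foldDiff)
    (fun i y => ?_) x
  change G.foldDiff (totalMap φ (F.inc i y)) = totalMap φ (F.foldDiff (F.inc i y))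
  cases i with
  | zero => rw [totalMap_inc, foldDiff_inc_zero, foldDiff_inc_zero, map_zero]
  | succ i => rw [totalMap_inc, foldDiff_inc_succ, foldDiff_inc_succ, totalMap_inc, hφ]

/-- The endomorphism of the total module induced by a family of maps that lowers the homological
degree by two. -/
noncomputable def totalShift {F : FreeComplex k σ}
    (η : ∀ p, F.X (p + 2) →ₗ[MvPolynomial σ k] F.X p) : F.Total →ₗ[MvPolynomial σ k] F.Total :=
  DirectSum.toModule _ ℕ _ fun p =>
    match p with
    | 0 => 0
    | 1 => 0
    | p + 2 => F.inc p ∘ₗ η p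

section Shift

variable {F : FreeComplex k σ} (η : ∀ p, F.X (p + 2) →ₗ[MvPolynomial σ k] F.X p)

theorem totalShift_inc_zero (x : F.X 0) : totalShift η (F.inc 0 x) = 0 := by
  simp [totalShift, inc]

theorem totalShift_inc_one (x : F.X 1) : totalShift η (F.inc 1 x) = 0 := by
  simp [totalShift, inc]

theorem totalShift_inc_add_two (p : ℕ) (x : F.X (p + 2)) :
    totalShift η (F.inc (p + 2) x) = F.inc p (η p x) := by
  simp [totalShift, inc]

/-- A square-zero homogeneous family of maps of homological degree `-2` that anticommutes with the
differential of a complex defines a free flag anchored on it. -/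
theorem isFreeFlag_foldDiff_add_totalShift {a : ℤ}
    (hη : ∀ p, IsHomogeneousMap (F.gr (p + 2)) (F.gr p) (-a) (η p))
    (hd : ∀ p x, F.d p (η (p + 1) x) + η p (F.d (p + 2) x) = 0)
    (hsq : ∀ p x, η p (η (p + 2) x) = 0) : F.IsFreeFlag a (F.foldDiff + totalShift η) where
  isDifferentialModule :=
    { sq_zero := by
        refine DirectSum.linearMap_ext _ fun i => LinearMap.ext fun x => ?_
        change F.foldDiff (F.foldDiff (F.inc i x) + totalShift η (F.inc i x)) +
          totalShift η (F.foldDiff (F.inc i x) + totalShift η (F.inc i x)) = 0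
        rw [map_add, foldDiff_foldDiff, zero_add, map_add]
        -- In the square of `d + η`, the mixed term `d η + η d` lowers the homological degree by
        -- three and `η η` by four; hence the separate treatment of the degrees below four.
        match i with
        | 0 => simp only [totalShift_inc_zero, foldDiff_inc_zero, map_zero, add_zero]
        | 1 => simp only [totalShift_inc_one, foldDiff_inc_succ, totalShift_inc_zero, map_zero,
            add_zero]
        | 2 => simp only [totalShift_inc_add_two, foldDiff_inc_succ, foldDiff_inc_zero,
            totalShift_inc_zero, totalShift_inc_one, add_zero]
        | 3 =>
          simp only [totalShift_inc_add_two, foldDiff_inc_succ, totalShift_inc_one, add_zero]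
          rw [← map_add, hd, map_zero]
        | i + 4 =>
          simp only [totalShift_inc_add_two, foldDiff_inc_succ]
          rw [hsq, map_zero, add_zero, ← map_add, hd, map_zero]
      homogeneous := by
        intro m x hx
        refine F.map_mem_of_mem_foldGrading _ (fun i y hy => ?_) hx
        refine add_mem (F.foldDiff_inc_mem_foldGrading i hy) ?_
        match i, y, hy with
        | 0, y, _ =>
          rw [totalShift_inc_zero]
          exact zero_mem _
        | 1, y, _ =>
          rw [totalShift_inc_one]
          exact zero_mem _
        | i + 2, y, hy =>
          rw [totalShift_inc_add_two]
          refine F.inc_mem_foldGrading ?_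
          convert hη i _ _ hy using 2
          push_cast
          ring }
  flag := by
    intro i j x hij
    change (F.foldDiff (F.inc i x) + totalShift η (F.inc i x)) j = 0
    match i with
    | 0 => rw [foldDiff_inc_zero, totalShift_inc_zero, add_zero, DirectSum.zero_apply]
    | 1 => rw [foldDiff_inc_succ, totalShift_inc_one, add_zero, F.inc_apply_ne (by omega)]
    | i + 2 => rw [foldDiff_inc_succ, totalShift_inc_add_two, DirectSum.add_apply,
        F.inc_apply_ne (by omega), F.inc_apply_ne (by omega), add_zero]
  anchor := by
    intro i x
    change (F.foldDiff (F.inc (i + 1) x) + totalShift η (F.inc (i + 1) x)) i = F.d i x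
    cases i with
    | zero => rw [foldDiff_inc_succ, totalShift_inc_one, add_zero, inc_apply_same]
    | succ i => rw [foldDiff_inc_succ, totalShift_inc_add_two, DirectSum.add_apply, inc_apply_same,
        F.inc_apply_ne (by omega), add_zero]

end Shift

/-- Let `K` be a homotopy retract of `F`. If `F` is rigid, then every square-zero family `ψ` of
maps of homological degree `-2` on `K` that anticommutes with the differential vanishes modulo
every ideal modulo which the differential of `K` vanishes. -/
theorem IsRigid.mem_smul_top {F K : FreeComplex k σ} {a : ℤ} (hF : F.IsRigid a)
    [Module.Finite (MvPolynomial σ k) K.Total] (I : Ideal (MvPolynomial σ k))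
    (hI : ∀ p x, K.d p x ∈ I • (⊤ : Submodule (MvPolynomial σ k) (K.X p)))
    (i : ∀ p, K.X p →ₗ[MvPolynomial σ k] F.X p) (π : ∀ p, F.X p →ₗ[MvPolynomial σ k] K.X p)
    (hi : ∀ p, IsHomogeneousMap (K.gr p) (F.gr p) 0 (i p))
    (hπ : ∀ p, IsHomogeneousMap (F.gr p) (K.gr p) 0 (π p))
    (hid : ∀ p x, F.d p (i (p + 1) x) = i p (K.d p x))
    (hπd : ∀ p x, K.d p (π (p + 1) x) = π p (F.d p x)) (hπi : ∀ p x, π p (i p x) = x)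
    (H : ∀ p, F.X p →ₗ[MvPolynomial σ k] F.X (p + 1)) (hH0 : ∀ x, F.d 0 (H 0 x) = x - i 0 (π 0 x))
    (hH : ∀ p x, F.d (p + 1) (H (p + 1) x) + H p (F.d p x) = x - i (p + 1) (π (p + 1) x))
    (ψ : ∀ p, K.X (p + 2) →ₗ[MvPolynomial σ k] K.X p)
    (hψ : ∀ p, IsHomogeneousMap (K.gr (p + 2)) (K.gr p) (-a) (ψ p))
    (hψd : ∀ p x, K.d p (ψ (p + 1) x) + ψ p (K.d (p + 2) x) = 0)
    (hψψ : ∀ p x, ψ p (ψ (p + 2) x) = 0) (p : ℕ) (x : K.X (p + 2)) :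
    ψ p x ∈ I • (⊤ : Submodule (MvPolynomial σ k) (K.X p)) := by
  let η : ∀ p, F.X (p + 2) →ₗ[MvPolynomial σ k] F.X p := fun p => i p ∘ₗ ψ p ∘ₗ π (p + 2)
  have hη : ∀ p x, η p x = i p (ψ p (π (p + 2) x)) := fun _ _ => rfl
  have hflag : F.IsFreeFlag a (F.foldDiff + totalShift η) := by
    refine isFreeFlag_foldDiff_add_totalShift η (fun p m x hx => ?_) (fun p x => ?_) fun p x => ?_
    · have h1 := hπ (p + 2) m x hx
      have h2 := hi p _ _ (hψ p _ _ h1)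
      rw [hη]
      convert h2 using 2
      ring
    · rw [hη, hη, hid, ← hπd, ← map_add, hψd, map_zero]
    · rw [hη, hη, hπi, hψψ, map_zero]
  -- Only compatibility with the differentials is kept: the argument needs neither the grading nor
  -- any filtration to be respected by `e`.
  obtain ⟨e, -, he⟩ := hF _ hflag
  let G : F.Total →ₗ[MvPolynomial σ k] F.Total :=
    DirectSum.toModule _ ℕ _ fun p => F.inc (p + 1) ∘ₗ H p
  have hG : ∀ p x, G (F.inc p x) = F.inc (p + 1) (H p x) := fun p x =>
    DirectSum.toModule_lof _ _ _
  have key := mem_smul_top_of_perturbation_equiv I K.foldDiff (totalShift ψ) F.foldDiff G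
    (totalMap i) (totalMap π) e (foldDiff_totalMap hid)
    (fun x => (foldDiff_totalMap hπd x).symm) ?_ ?_ ?_ ?_ (K.inc (p + 2) x)
  · rw [totalShift_inc_add_two] at key
    have := map_mem_smul_top I (DirectSum.component (MvPolynomial σ k) ℕ K.X p) key
    rwa [DirectSum.component.lof_self] at this
  · refine K.linearMap_ext_inc (f := totalMap π ∘ₗ totalMap i) (g := LinearMap.id) fun p y => ?_
    change totalMap π (totalMap i (K.inc p y)) = K.inc p y
    rw [totalMap_inc, totalMap_inc, hπi]
  · refine F.linearMap_ext_inc (f := F.foldDiff ∘ₗ G + G ∘ₗ F.foldDiff)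
      (g := LinearMap.id - totalMap i ∘ₗ totalMap π) fun p y => ?_
    change F.foldDiff (G (F.inc p y)) + G (F.foldDiff (F.inc p y)) =
      F.inc p y - totalMap i (totalMap π (F.inc p y))
    rw [totalMap_inc, totalMap_inc, hG, foldDiff_inc_succ]
    cases p with
    | zero => rw [foldDiff_inc_zero, map_zero, add_zero, hH0, map_sub]
    | succ p => rw [foldDiff_inc_succ, hG, ← map_add, hH, map_sub]
  · intro x
    rw [← he]
    congr 1
    refine congrArg (F.foldDiff x + ·) ?_
    refine (F.linearMap_ext_inc (f := totalShift η)
      (g := totalMap i ∘ₗ totalShift ψ ∘ₗ totalMap π) (fun p y => ?_) x).symm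
    change totalShift η (F.inc p y) = totalMap i (totalShift ψ (totalMap π (F.inc p y)))
    rw [totalMap_inc]
    match p with
    | 0 => rw [totalShift_inc_zero, totalShift_inc_zero, map_zero]
    | 1 => rw [totalShift_inc_one, totalShift_inc_one, map_zero]
    | p + 2 => rw [totalShift_inc_add_two, totalShift_inc_add_two, totalMap_inc, hη]
  · intro x
    obtain ⟨s, hs⟩ := K.exists_eq_sum_inc x
    rw [hs, map_sum]
    refine sum_mem fun p _ => ?_
    cases p with
    | zero =>
      rw [foldDiff_inc_zero]
      exact zero_mem _
    | succ p =>
      rw [foldDiff_inc_succ]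
      exact map_mem_smul_top I (K.inc p) (hI p _)

end FreeComplex

/-! ### The exterior algebra in coordinates and exactness of the Koszul complex. -/

namespace Koszul

variable {R : Type*} [CommRing R] {n : ℕ}

/-- The sign `(-1)^#{j ∈ J | j < i}`. -/
def sgn (R : Type*) [CommRing R] (i : Fin n) (J : Finset (Fin n)) : R :=
  (-1) ^ (J.filter (· < i)).card

theorem sgn_mul_self (i : Fin n) (J : Finset (Fin n)) : sgn R i J * sgn R i J = 1 := by
  rw [sgn, ← mul_pow]
  simp

theorem sgn_insert {i j : Fin n} {J : Finset (Fin n)} (hj : j ∉ J) :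
    sgn R i (insert j J) = if j < i then -sgn R i J else sgn R i J := by
  unfold sgn
  rw [Finset.filter_insert]
  split_ifs
  · rw [Finset.card_insert_of_notMem (fun h => hj (Finset.mem_filter.1 h).1), pow_succ, mul_neg_one]
  · rfl

theorem sgn_insert_self {i : Fin n} {J : Finset (Fin n)} (hi : i ∉ J) :
    sgn R i (insert i J) = sgn R i J := by
  rw [sgn_insert hi, if_neg (lt_irrefl i)]

/-- Exactly one of `i < j` and `j < i` holds, so exactly one of the two insertions changes a sign.
-/
theorem sgn_mul_sgn_insert {i j : Fin n} {J : Finset (Fin n)} (hij : i ≠ j) (hi : i ∉ J)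
    (hj : j ∉ J) :
    sgn R i J * sgn R j (insert i J) = -(sgn R j J * sgn R i (insert j J)) := by
  rw [sgn_insert hi, sgn_insert hj]
  rcases hij.lt_or_gt with h | h
  · rw [if_pos h, if_neg h.asymm]
    ring
  · rw [if_neg h.asymm, if_pos h]
    ring

/-- The contraction with the `i`-th dual basis vector on the exterior algebra of a free module,
in coordinates. -/
def contr (R : Type*) [CommRing R] (i : Fin n) :
    (Finset (Fin n) → R) →ₗ[R] (Finset (Fin n) → R) where
  toFun x J := if i ∈ J then 0 else sgn R i J * x (insert i J)
  map_add' x y := by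
    ext J
    by_cases h : i ∈ J <;> simp [h, mul_add]
  map_smul' c x := by
    ext J
    by_cases h : i ∈ J <;> simp [h, mul_left_comm]

/-- The multiplication by the `i`-th basis vector on the exterior algebra of a free module,
in coordinates. -/
def wedge (R : Type*) [CommRing R] (i : Fin n) :
    (Finset (Fin n) → R) →ₗ[R] (Finset (Fin n) → R) where
  toFun x J := if i ∈ J then sgn R i J * x (J.erase i) else 0
  map_add' x y := by
    ext J
    by_cases h : i ∈ J <;> simp [h, mul_add]
  map_smul' c x := by
    ext J
    by_cases h : i ∈ J <;> simp [h, mul_left_comm]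

theorem contr_apply (i : Fin n) (x : Finset (Fin n) → R) (J : Finset (Fin n)) :
    contr R i x J = if i ∈ J then 0 else sgn R i J * x (insert i J) := rfl

theorem wedge_apply (i : Fin n) (x : Finset (Fin n) → R) (J : Finset (Fin n)) :
    wedge R i x J = if i ∈ J then sgn R i J * x (J.erase i) else 0 := rfl

theorem contr_contr_self (i : Fin n) (x : Finset (Fin n) → R) :
    contr R i (contr R i x) = 0 := by
  ext J
  simp [contr_apply]

theorem contr_contr (i j : Fin n) (x : Finset (Fin n) → R) :
    contr R i (contr R j x) = -contr R j (contr R i x) := by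
  by_cases hij : i = j
  · subst hij
    rw [contr_contr_self, neg_zero]
  ext J
  simp only [contr_apply, Pi.neg_apply]
  by_cases hi : i ∈ J
  · simp [hi]
  by_cases hj : j ∈ J
  · simp [hj]
  have h1 : j ∉ insert i J := by simp [hj, Ne.symm hij]
  have h2 : i ∉ insert j J := by simp [hi, hij]
  rw [if_neg hi, if_neg hj, if_neg h1, if_neg h2, ← mul_assoc, sgn_mul_sgn_insert hij hi hj,
    Finset.insert_comm]
  ring

theorem contr_wedge_self (i : Fin n) (x : Finset (Fin n) → R) :
    contr R i (wedge R i x) + wedge R i (contr R i x) = x := by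
  ext J
  simp only [contr_apply, wedge_apply, Pi.add_apply]
  by_cases hi : i ∈ J
  · obtain ⟨J, hJ, rfl⟩ : ∃ J', i ∉ J' ∧ insert i J' = J :=
      ⟨J.erase i, Finset.notMem_erase i J, Finset.insert_erase hi⟩
    rw [if_pos hi, if_pos hi, Finset.erase_insert hJ, if_neg hJ, sgn_insert_self hJ, ← mul_assoc,
      sgn_mul_self, one_mul, zero_add]
  · rw [if_neg hi, if_neg hi, if_pos (Finset.mem_insert_self i J), Finset.erase_insert hi,
      sgn_insert_self hi, ← mul_assoc, sgn_mul_self, one_mul, add_zero]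

theorem contr_wedge {i j : Fin n} (hij : i ≠ j) (x : Finset (Fin n) → R) :
    contr R i (wedge R j x) = -wedge R j (contr R i x) := by
  ext J
  simp only [contr_apply, wedge_apply, Pi.neg_apply]
  by_cases hi : i ∈ J
  · simp [hi, hij]
  by_cases hj : j ∈ J
  · obtain ⟨J, hJ, rfl⟩ : ∃ J', j ∉ J' ∧ insert j J' = J :=
      ⟨J.erase j, Finset.notMem_erase j J, Finset.insert_erase hj⟩
    have hi' : i ∉ J := fun h => hi (Finset.mem_insert_of_mem h)
    have h1 : j ∉ insert i J := by simp [hJ, Ne.symm hij]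
    rw [if_neg hi, if_pos (Finset.mem_insert_of_mem hj), if_pos hj, Finset.erase_insert hJ,
      if_neg hi', Finset.insert_comm, Finset.erase_insert h1, sgn_insert_self h1,
      sgn_insert_self hJ, ← mul_assoc, ← mul_assoc, sgn_insert hJ, sgn_insert hi']
    rcases hij.lt_or_gt with h | h
    · rw [if_pos h, if_neg h.asymm]
      ring
    · rw [if_neg h.asymm, if_pos h]
      ring
  · have h1 : j ∉ insert i J := by simp [hj, Ne.symm hij]
    simp [hj, h1]

/-- The differential of the Koszul complex on `f`. -/
def diff (f : Fin n → R) : (Finset (Fin n) → R) →ₗ[R] (Finset (Fin n) → R) :=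
  ∑ i, f i • contr R i

theorem diff_apply (f : Fin n → R) (x : Finset (Fin n) → R) :
    diff f x = ∑ i, f i • contr R i x := by
  simp [diff]

theorem diff_contr (f : Fin n → R) (j : Fin n) (x : Finset (Fin n) → R) :
    diff f (contr R j x) = -contr R j (diff f x) := by
  rw [diff_apply, diff_apply, map_sum, ← Finset.sum_neg_distrib]
  exact Finset.sum_congr rfl fun i _ => by rw [contr_contr, map_smul, smul_neg]

/-- Multiplication by the `j`-th basis vector is a homotopy for multiplication by `f j`. Both the
boundaries in degree zero and the exactness argument rest on this. -/
theorem diff_wedge (f : Fin n → R) (j : Fin n) (x : Finset (Fin n) → R) :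
    diff f (wedge R j x) + wedge R j (diff f x) = f j • x := by
  rw [diff_apply, diff_apply, map_sum, ← Finset.sum_add_distrib, Finset.sum_eq_single j]
  · rw [map_smul, ← smul_add, contr_wedge_self]
  · intro i _ hi
    rw [map_smul, contr_wedge hi, smul_neg, neg_add_cancel]
  · simp

/-- Induction on the set of indices shows that the mixed terms cancel in pairs and the square terms
vanish separately; antisymmetry alone would give only `2 * _ = 0`, which is useless in
characteristic two. -/
theorem diff_diff (f : Fin n → R) (x : Finset (Fin n) → R) : diff f (diff f x) = 0 := by
  have key : ∀ A : Finset (Fin n),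
      ∑ i ∈ A, f i • contr R i (∑ j ∈ A, f j • contr R j x) = 0 := by
    intro A
    induction A using Finset.induction_on with
    | empty => simp
    | insert r A hr ih =>
      have h1 : ∑ i ∈ A, f i • contr R i (f r • contr R r x) =
          -(f r • contr R r (∑ j ∈ A, f j • contr R j x)) := by
        rw [map_sum, Finset.smul_sum, ← Finset.sum_neg_distrib]
        refine Finset.sum_congr rfl fun i _ => ?_
        rw [map_smul, map_smul, contr_contr, smul_neg, smul_neg, smul_comm]
      simp only [Finset.sum_insert hr]
      simp only [map_add, smul_add, Finset.sum_add_distrib]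
      rw [ih, h1, map_smul, contr_contr_self]
      simp
  rw [diff_apply, diff_apply]
  exact key Finset.univ

/-- The elements of the exterior algebra that involve the first `r` basis vectors only. -/
def supp (R : Type*) [CommRing R] (n r : ℕ) : Submodule R (Finset (Fin n) → R) where
  carrier := {x | ∀ J : Finset (Fin n), (∃ j ∈ J, r ≤ (j : ℕ)) → x J = 0}
  zero_mem' := fun _ _ => rfl
  add_mem' := fun {x y} hx hy J hJ => by rw [Pi.add_apply, hx J hJ, hy J hJ, add_zero]
  smul_mem' := fun c x hx J hJ => by rw [Pi.smul_apply, hx J hJ, smul_zero]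

theorem supp_mono {r s : ℕ} (h : r ≤ s) : supp R n r ≤ supp R n s :=
  fun _ hx J ⟨j, hj, hj'⟩ => hx J ⟨j, hj, h.trans hj'⟩

theorem contr_mem_supp {r : ℕ} (i : Fin n) {x : Finset (Fin n) → R} (hx : x ∈ supp R n r) :
    contr R i x ∈ supp R n r := by
  rintro J ⟨j, hj, hj'⟩
  rw [contr_apply, hx (insert i J) ⟨j, Finset.mem_insert_of_mem hj, hj'⟩]
  simp

theorem contr_mem_supp_of_succ {r : Fin n} {x : Finset (Fin n) → R}
    (hx : x ∈ supp R n ((r : ℕ) + 1)) : contr R r x ∈ supp R n r := by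
  rintro J ⟨j, hj, hj'⟩
  rw [contr_apply]
  split_ifs with h
  · rfl
  · have : j ≠ r := fun h' => h (h' ▸ hj)
    have h2 : (r : ℕ) ≠ j := fun h' => this (Fin.ext h'.symm)
    rw [hx (insert r J) ⟨j, Finset.mem_insert_of_mem hj, by omega⟩, mul_zero]

theorem wedge_mem_supp {r : ℕ} {i : Fin n} (hi : (i : ℕ) < r) {x : Finset (Fin n) → R}
    (hx : x ∈ supp R n r) : wedge R i x ∈ supp R n r := by
  rintro J ⟨j, hj, hj'⟩
  rw [wedge_apply]
  split_ifs with h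
  · have : j ≠ i := fun h' => by
      subst h'
      omega
    rw [hx (J.erase i) ⟨j, Finset.mem_erase.2 ⟨this, hj⟩, hj'⟩, mul_zero]
  · rfl

theorem single_mem_supp (r : ℕ) (c : R) : (Pi.single ∅ c : Finset (Fin n) → R) ∈ supp R n r := by
  rintro J ⟨j, hj, -⟩
  exact Pi.single_eq_of_ne (M := fun _ => R) (Finset.ne_empty_of_mem hj) c

theorem contr_single (i : Fin n) (c : R) : contr R i (Pi.single ∅ c) = 0 := by
  ext J
  rw [contr_apply, Pi.single_eq_of_ne (Finset.insert_ne_empty i J)]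
  simp

theorem diff_single (f : Fin n → R) (c : R) : diff f (Pi.single ∅ c) = 0 := by
  simp [diff_apply, contr_single]

theorem diff_apply_empty_mem (f : Fin n → R) {r : ℕ} {x : Finset (Fin n) → R}
    (hx : x ∈ supp R n r) : diff f x ∅ ∈ Ideal.span (f '' {i | (i : ℕ) < r}) := by
  rw [diff_apply, Finset.sum_apply]
  refine sum_mem fun i _ => ?_
  rw [Pi.smul_apply, smul_eq_mul]
  by_cases hi : (i : ℕ) < r
  · exact Ideal.mul_mem_right _ _ (Ideal.subset_span ⟨i, hi, rfl⟩)
  · rw [contr_apply, hx (insert i ∅) ⟨i, Finset.mem_insert_self i ∅, not_lt.1 hi⟩]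
    simp

theorem exists_diff_eq_single (f : Fin n → R) {r : ℕ} {c : R}
    (hc : c ∈ Ideal.span (f '' {i | (i : ℕ) < r})) :
    ∃ v ∈ supp R n r, diff f v = Pi.single ∅ c := by
  induction hc using Submodule.span_induction with
  | mem c hc =>
    obtain ⟨i, hi, rfl⟩ := hc
    refine ⟨wedge R i (Pi.single ∅ 1), wedge_mem_supp hi (single_mem_supp r 1), ?_⟩
    have := diff_wedge f i (Pi.single ∅ 1)
    rw [diff_single, map_zero, add_zero] at this
    rw [this, ← Pi.single_smul, smul_eq_mul, mul_one]
  | zero => exact ⟨0, zero_mem _, by simp⟩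
  | add c c' _ _ h h' =>
    obtain ⟨v, hv, hv'⟩ := h
    obtain ⟨w, hw, hw'⟩ := h'
    exact ⟨v + w, add_mem hv hw, by rw [map_add, hv', hw', Pi.single_add]⟩
  | smul c c' _ h =>
    obtain ⟨v, hv, hv'⟩ := h
    exact ⟨c • v, Submodule.smul_mem _ _ hv, by rw [map_smul, hv', ← Pi.single_smul]⟩

/-- The Koszul complex on a weakly regular sequence is exact in positive degrees. -/
theorem exists_eq_diff_add_single (f : Fin n → R)
    (hf : ∀ (r : Fin n) (c : R), f r * c ∈ Ideal.span (f '' {i | (i : ℕ) < r}) →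
      c ∈ Ideal.span (f '' {i | (i : ℕ) < r}))
    (r : ℕ) (hr : r ≤ n) (x : Finset (Fin n) → R) (hx : x ∈ supp R n r) (hd : diff f x = 0) :
    ∃ w ∈ supp R n r, ∃ c, x = diff f w + Pi.single ∅ c := by
  induction r generalizing x with
  | zero =>
    refine ⟨0, zero_mem _, x ∅, ?_⟩
    rw [map_zero, zero_add]
    ext J
    by_cases hJ : J = ∅
    · rw [hJ, Pi.single_eq_same]
    · obtain ⟨j, hj⟩ := Finset.nonempty_iff_ne_empty.2 hJ
      rw [Pi.single_eq_of_ne hJ, hx J ⟨j, hj, Nat.zero_le _⟩]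
  | succ r ih =>
    -- Write `x = x₀ + e_ρ ∧ y` with `x₀`, `y` free of `e_ρ`. Then `d y = 0` and `d x₀ = -f ρ • y`.
    -- By induction `y` is a boundary up to a constant `c`, and regularity of `f ρ` makes `c` a
    -- boundary too. Subtracting the boundary of a multiple of `e_ρ` reduces to a cycle without
    -- `e_ρ`.
    let ρ : Fin n := ⟨r, hr⟩
    have ih' := ih (Nat.le_of_succ_le hr)
    set y := contr R ρ x with hy
    set x₀ := contr R ρ (wedge R ρ x) with hx₀
    have hxy : x₀ + wedge R ρ y = x := contr_wedge_self ρ x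
    have hys : y ∈ supp R n r := contr_mem_supp_of_succ (r := ρ) hx
    have hx₀s : x₀ ∈ supp R n r := contr_mem_supp_of_succ (r := ρ)
      (wedge_mem_supp (Nat.lt_succ_self r) hx)
    have hdy : diff f y = 0 := by rw [hy, diff_contr, hd, map_zero, neg_zero]
    obtain ⟨v, hv, c, hvc⟩ := ih' y hys hdy
    have hwy : diff f (wedge R ρ y) = f ρ • y := by
      have := diff_wedge f ρ y
      rwa [hdy, map_zero, add_zero] at this
    have hdx₀ : diff f x₀ = -(f ρ • y) := by
      have : diff f x₀ + f ρ • y = 0 := by rw [← hwy, ← map_add, hxy, hd]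
      exact eq_neg_of_add_eq_zero_left this
    obtain ⟨v', hv', hvc'⟩ : ∃ v' ∈ supp R n r, diff f v' = Pi.single ∅ c := by
      -- The coordinate at `∅` of `d (x₀ + f ρ • v) = -f ρ • c` shows that `f ρ * c` lies in the
      -- ideal of the earlier forms.
      refine exists_diff_eq_single f (hf ρ c ?_)
      have h1 : diff f (x₀ + f ρ • v) = -(f ρ • Pi.single ∅ c) := by
        rw [map_add, map_smul, hdx₀, hvc, smul_add]
        abel
      have h2 := diff_apply_empty_mem f (add_mem hx₀s (Submodule.smul_mem _ (f ρ) hv))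
      rw [h1, Pi.neg_apply, Pi.smul_apply, Pi.single_eq_same, neg_mem_iff, smul_eq_mul] at h2
      exact h2
    have hyv : y = diff f (v + v') := by rw [map_add, hvc', hvc]
    obtain ⟨w, hw, c', hwc⟩ := ih' (x₀ + f ρ • (v + v'))
      (add_mem hx₀s (Submodule.smul_mem _ _ (add_mem hv hv')))
      (by rw [map_add, map_smul, hdx₀, ← hyv, neg_add_cancel])
    refine ⟨w - wedge R ρ (v + v'), sub_mem (supp_mono (Nat.le_succ r) hw)
      (wedge_mem_supp (Nat.lt_succ_self r) (supp_mono (Nat.le_succ r) (add_mem hv hv'))), c', ?_⟩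
    have h3 := diff_wedge f ρ (v + v')
    rw [← hyv] at h3
    rw [map_sub, eq_sub_of_add_eq h3, ← hxy, eq_sub_of_add_eq hwc]
    abel

end Koszul

/-! ### Graded free modules on coordinates and a graded Nakayama lemma. -/

section FreeGrading

variable {k : Type u} [Field k] {σ : Type} {ι : Type}

theorem exists_sum_proj {M : Type*} [AddCommGroup M] {𝓜 : ℤ → AddSubgroup M}
    (h : DirectSum.IsInternal 𝓜) (x : M) :
    ∃ T : Finset ℤ, ∀ T', T ⊆ T' → x = ∑ m ∈ T', proj h m x := by
  induction x using grading_induction h with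
  | h0 => exact ⟨∅, fun T' _ => by simp⟩
  | hadd x y hx hy =>
    obtain ⟨T, hT⟩ := hx
    obtain ⟨T', hT'⟩ := hy
    refine ⟨T ∪ T', fun T'' h'' => ?_⟩
    simp only [map_add, Finset.sum_add_distrib]
    rw [← hT _ (Finset.union_subset_left h''), ← hT' _ (Finset.union_subset_right h'')]
  | hmem i x hx =>
    refine ⟨{i}, fun T' hT' => ?_⟩
    rw [Finset.sum_congr rfl fun m _ => proj_of_mem h m hx, Finset.sum_ite_eq,
      if_pos (Finset.singleton_subset_iff.1 hT')]

/-- The grading of the free module with a basis in the degrees `deg`. -/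
def freeGrading (k : Type u) [Field k] (σ : Type) {ι : Type} (deg : ι → ℤ) (m : ℤ) :
    AddSubgroup (ι → MvPolynomial σ k) where
  carrier := {x | ∀ j, x j ∈ polyGrading k σ (m - deg j)}
  zero_mem' := fun _ => zero_mem _
  add_mem' := fun hx hy j => add_mem (hx j) (hy j)
  neg_mem' := fun hx j => neg_mem (hx j)

theorem isGrading_freeGrading [Fintype ι] (deg : ι → ℤ) :
    IsGrading (k := k) (σ := σ) (freeGrading k σ deg) where
  isInternal := by
    classical
    refine isInternal_of_proj
      (fun m => AddMonoidHom.mk' (fun x j => proj isInternal_polyGrading (m - deg j) (x j))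
        fun x y => funext fun j => map_add _ _ _) ?_ ?_ ?_
    · intro m x j
      exact proj_mem _ _ _
    · intro i m x hx
      funext j
      change proj isInternal_polyGrading (m - deg j) (x j) = _
      rw [proj_of_mem _ _ (hx j)]
      by_cases h : i = m
      · rw [if_pos h, if_pos (by rw [h])]
      · rw [if_neg h, if_neg (by omega)]
        rfl
    · intro x
      choose T hT using fun j => exists_sum_proj (isInternal_polyGrading (k := k) (σ := σ)) (x j)
      refine ⟨Finset.univ.biUnion fun j => (T j).image (· + deg j), ?_⟩
      funext j
      rw [Finset.sum_apply]
      change x j = ∑ m ∈ _, proj isInternal_polyGrading (m - deg j) (x j)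
      rw [← Finset.sum_image (g := (· - deg j)) (f := fun m => proj isInternal_polyGrading m (x j))
        fun a _ b _ h => sub_left_injective h]
      refine hT j _ fun m hm => Finset.mem_image.2 ⟨m + deg j, ?_, by simp⟩
      exact Finset.mem_biUnion.2 ⟨j, Finset.mem_univ _, Finset.mem_image_of_mem _ hm⟩
  smul_mem := fun i j p x hp hx l => by
    rw [Pi.smul_apply, smul_eq_mul, add_sub_assoc]
    exact mul_mem_polyGrading hp (hx l)

theorem basisFun_mem_freeGrading [Fintype ι] (deg : ι → ℤ) (j : ι) :
    Pi.basisFun (MvPolynomial σ k) ι j ∈ freeGrading k σ deg (deg j) := by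
  classical
  intro l
  rw [Pi.basisFun_apply]
  by_cases h : l = j
  · subst h
    rw [Pi.single_eq_same, sub_self]
    exact one_mem_polyGrading
  · rw [Pi.single_eq_of_ne h]
    exact zero_mem _

theorem isGradedFree_freeGrading [Fintype ι] (deg : ι → ℤ) :
    IsGradedFree k σ (freeGrading k σ deg) := by
  refine ⟨isGrading_freeGrading deg, Fintype.card ι,
    (Pi.basisFun (MvPolynomial σ k) ι).reindex (Fintype.equivFin ι),
    fun j => deg ((Fintype.equivFin ι).symm j), fun j => ?_⟩
  rw [Module.Basis.reindex_apply]
  exact basisFun_mem_freeGrading deg _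

theorem eq_zero_of_mem_of_mem_polyGrading {I : Ideal (MvPolynomial σ k)} (hI : I ≠ ⊤) {m : ℤ}
    (hm : m ≤ 0) {p : MvPolynomial σ k} (hp : p ∈ polyGrading k σ m) (hpI : p ∈ I) : p = 0 := by
  rcases hm.lt_or_eq with hm | rfl
  · exact eq_zero_of_mem_polyGrading_of_neg hm hp
  · have h0 : p.IsHomogeneous 0 := mem_polyGrading_natCast.1 (by exact_mod_cast hp)
    rw [← MvPolynomial.totalDegree_zero_iff_isHomogeneous,
      MvPolynomial.totalDegree_eq_zero_iff_eq_C] at h0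
    by_contra hne
    refine hI (Ideal.eq_top_of_isUnit_mem I hpI ?_)
    rw [h0]
    refine (isUnit_iff_ne_zero.2 fun h => hne ?_).map MvPolynomial.C
    rw [h0, h, map_zero]

/-- A homogeneous endomorphism of a graded free module that is the identity modulo a proper ideal is
bijective. -/
theorem bijective_of_sub_mem_smul_top [Fintype ι] (deg : ι → ℕ) {I : Ideal (MvPolynomial σ k)}
    (hI : I ≠ ⊤) (v : (ι → MvPolynomial σ k) →ₗ[MvPolynomial σ k] (ι → MvPolynomial σ k))
    (hv : IsHomogeneousMap (freeGrading k σ fun j => (deg j : ℤ))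
      (freeGrading k σ fun j => (deg j : ℤ)) 0 v)
    (hvI : ∀ x, x - v x ∈ I • (⊤ : Submodule (MvPolynomial σ k) (ι → MvPolynomial σ k))) :
    Function.Bijective v := by
  classical
  set b := Pi.basisFun (MvPolynomial σ k) ι with hb
  have hbm : ∀ j, b j ∈ freeGrading k σ (fun j => (deg j : ℤ)) (deg j) := fun j =>
    basisFun_mem_freeGrading (fun j => (deg j : ℤ)) j
  have hrange : ∀ (N : ℕ) (j : ι), deg j = N → b j ∈ LinearMap.range v := by
    intro N
    induction N using Nat.strong_induction_on with
    | _ N ih =>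
      intro j hj
      set y := b j - v (b j) with hy
      have hy1 : y ∈ LinearMap.range v := by
        rw [← b.sum_repr y]
        refine sum_mem fun l _ => ?_
        -- The error `y` is homogeneous of degree `N` with coordinates in `I`. A coordinate at a
        -- basis vector of degree at least `N` has degree at most zero, hence vanishes as `I` is
        -- proper; the others are covered by induction.
        by_cases hl : deg l < N
        · exact Submodule.smul_mem _ _ (ih _ hl l rfl)
        · have h1 : y l ∈ polyGrading k σ ((deg j : ℤ) - deg l) := by
            have := hv _ _ (hbm j)
            rw [add_zero] at this
            exact sub_mem (hbm j) this l
          have h2 : y l ∈ I := by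
            have := map_mem_smul_top I (LinearMap.proj (R := MvPolynomial σ k) l) (hvI (b j))
            rwa [smul_eq_mul, Ideal.mul_top] at this
          have h3 : y l = 0 := eq_zero_of_mem_of_mem_polyGrading hI (by omega) h1 h2
          rw [hb, Pi.basisFun_repr, h3, zero_smul]
          exact zero_mem _
      have h := add_mem hy1 (LinearMap.mem_range_self v (b j))
      rwa [hy, sub_add_cancel] at h
  have hsurj : Function.Surjective v := by
    rw [← LinearMap.range_eq_top, eq_top_iff, ← b.span_eq, Submodule.span_le]
    rintro _ ⟨j, rfl⟩
    exact hrange _ j rfl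
  exact ⟨OrzechProperty.injective_of_surjective_endomorphism v hsurj, hsurj⟩

end FreeGrading

/-! ### The grading of the quotient by a homogeneous ideal. -/

section Quotient

variable {k : Type u} [Field k] {σ : Type}

theorem isGrading_polyGrading : IsGrading (k := k) (σ := σ) (polyGrading k σ) where
  isInternal := isInternal_polyGrading
  smul_mem := fun _ _ _ _ hp hx => mul_mem_polyGrading hp hx

theorem proj_mem_span {ι : Type*} [Fintype ι] {f : ι → MvPolynomial σ k} {d : ι → ℤ}
    (hf : ∀ i, f i ∈ polyGrading k σ (d i)) {p : MvPolynomial σ k}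
    (hp : p ∈ Ideal.span (Set.range f)) (m : ℤ) :
    proj isInternal_polyGrading m p ∈ Ideal.span (Set.range f) := by
  obtain ⟨c, rfl⟩ := Ideal.mem_span_range_iff_exists_fun.1 hp
  rw [map_sum]
  refine sum_mem fun i _ => ?_
  rw [← smul_eq_mul, proj_smul isGrading_polyGrading (c i) (hf i)]
  exact Ideal.mul_mem_left _ _ (Ideal.subset_span ⟨i, rfl⟩)

theorem isInternal_quotientGrading (I : Ideal (MvPolynomial σ k))
    (hI : ∀ p ∈ I, ∀ m, proj isInternal_polyGrading m p ∈ I) :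
    DirectSum.IsInternal (quotientGrading I) := by
  classical
  constructor
  · rw [injective_iff_map_eq_zero]
    intro y hy
    choose p hp hpy using fun m => AddSubgroup.mem_map.1 (y m).2
    have hsum : ∑ m ∈ DFinsupp.support y, p m ∈ I := by
      rw [← Ideal.Quotient.eq_zero_iff_mem, map_sum, ← hy]
      conv_rhs => rw [← DirectSum.sum_support_of y, map_sum]
      refine Finset.sum_congr rfl fun m _ => ?_
      rw [DirectSum.coeAddMonoidHom_of]
      exact hpy m
    ext m
    by_cases hm : m ∈ DFinsupp.support y
    · have h1 := hI _ hsum m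
      rw [map_sum, Finset.sum_congr rfl fun i _ => proj_of_mem isInternal_polyGrading m (hp i),
        Finset.sum_ite_eq', if_pos hm, ← Ideal.Quotient.eq_zero_iff_mem] at h1
      rw [← hpy m]
      exact h1
    · rw [DFinsupp.notMem_support_iff.1 hm]
      rfl
  · intro x
    obtain ⟨p, rfl⟩ := Ideal.Quotient.mk_surjective x
    obtain ⟨T, hT⟩ := exists_sum_proj (isInternal_polyGrading (k := k) (σ := σ)) p
    refine ⟨∑ m ∈ T, DirectSum.of (fun i => quotientGrading I i) m
      ⟨Ideal.Quotient.mk I (proj isInternal_polyGrading m p), _, proj_mem _ m p, rfl⟩, ?_⟩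
    conv_rhs => rw [hT T subset_rfl, map_sum]
    rw [map_sum]
    exact Finset.sum_congr rfl fun m _ => DirectSum.coeAddMonoidHom_of _ _ _

end Quotient

/-! ### Passing from an arbitrary resolution to a minimal one. -/

namespace FreeComplex

variable {k : Type u} [Field k] {σ : Type}

/-- Let `K` be a resolution of `M` that is minimal in the sense that homogeneous endomorphisms that
are the identity modulo `I` are bijective. If some resolution of `M` is rigid, then every
square-zero family `ψ` of maps of homological degree `-2` on `K` that anticommutes with the
differential vanishes modulo `I`. -/
theorem IsResolution.mem_smul_top_of_isRigid {M : Type u} [AddCommGroup M]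
    [Module (MvPolynomial σ k) M] {𝓜 : ℤ → AddSubgroup M} (hM : DirectSum.IsInternal 𝓜)
    {F K : FreeComplex k σ} {ε : F.X 0 →ₗ[MvPolynomial σ k] M}
    {ε' : K.X 0 →ₗ[MvPolynomial σ k] M} (hF : F.IsResolution 𝓜 ε) (hK : K.IsResolution 𝓜 ε')
    {a : ℤ} (hrig : F.IsRigid a)
    [Module.Finite (MvPolynomial σ k) K.Total] (I : Ideal (MvPolynomial σ k))
    (hI : ∀ p x, K.d p x ∈ I • (⊤ : Submodule (MvPolynomial σ k) (K.X p)))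
    (hmin : ∀ p (v : K.X p →ₗ[MvPolynomial σ k] K.X p), IsHomogeneousMap (K.gr p) (K.gr p) 0 v →
      (∀ x, x - v x ∈ I • (⊤ : Submodule (MvPolynomial σ k) (K.X p))) → Function.Bijective v)
    (ψ : ∀ p, K.X (p + 2) →ₗ[MvPolynomial σ k] K.X p)
    (hψ : ∀ p, IsHomogeneousMap (K.gr (p + 2)) (K.gr p) (-a) (ψ p))
    (hψd : ∀ p x, K.d p (ψ (p + 1) x) + ψ p (K.d (p + 2) x) = 0)
    (hψψ : ∀ p x, ψ p (ψ (p + 2) x) = 0) (p : ℕ) (x : K.X (p + 2)) :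
    ψ p x ∈ I • (⊤ : Submodule (MvPolynomial σ k) (K.X p)) := by
  obtain ⟨s, hs, hsd, hsε⟩ := exists_comparison hK hF hM
  obtain ⟨π, hπ, hπd, hπε⟩ := exists_comparison hF hK hM
  obtain ⟨h, hh0, hh⟩ := exists_homotopy hK.exact_succ
    (fun p => LinearMap.id - π p ∘ₗ s p)
    (fun p x => by
      change K.d p (x - π (p + 1) (s (p + 1) x)) = K.d p x - π p (s p (K.d p x))
      rw [map_sub, hπd, hsd])
    (fun x => (hK.exact_zero _).1 (by
      change ε' (x - π 0 (s 0 x)) = 0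
      rw [map_sub, hπε, hsε, sub_self]))
  have hhom : ∀ p, IsHomogeneousMap (K.gr p) (K.gr p) 0 (π p ∘ₗ s p) := fun p m x hx => by
    have := hπ p _ _ (hs p m x hx)
    rwa [add_zero] at this
  -- `π s` is homotopic to the identity and the differential of `K` vanishes modulo `I`, so `π s` is
  -- the identity modulo `I` and `hmin` applies.
  have hbij : ∀ p, Function.Bijective (π p ∘ₗ s p) := by
    intro p
    refine hmin p _ (hhom p) fun x => ?_
    cases p with
    | zero =>
      have := hI 0 (h 0 x)
      rwa [hh0] at this
    | succ p =>
      have := add_mem (hI (p + 1) (h (p + 1) x)) (map_mem_smul_top I (h p) (hI p x))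
      rwa [hh] at this
  let e : ∀ p, K.X p ≃ₗ[MvPolynomial σ k] K.X p := fun p =>
    LinearEquiv.ofBijective (π p ∘ₗ s p) (hbij p)
  have he : ∀ p x, e p x = π p (s p x) := fun _ _ => rfl
  have he' : ∀ p x, π p (s p ((e p).symm x)) = x := fun p x => (e p).apply_symm_apply x
  have hes : ∀ p, IsHomogeneousMap (K.gr p) (K.gr p) 0 (e p).symm.toLinearMap := by
    intro p m x hx
    rw [add_zero]
    obtain ⟨y, hy, hyx⟩ := (hhom p).exists_preimage (K.isInternal p) (K.isInternal p) hx
      ⟨(e p).symm x, (e p).apply_symm_apply x⟩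
    rw [← hyx]
    change (e p).symm (e p y) ∈ _
    rwa [LinearEquiv.symm_apply_apply]
  have hesd : ∀ p x, K.d p ((e (p + 1)).symm x) = (e p).symm (K.d p x) := by
    intro p x
    rw [LinearEquiv.eq_symm_apply, he, ← hsd, ← hπd, he']
  -- Correcting `s` by the inverse of `π s` turns a homotopy equivalence into a strict retraction,
  -- `π t = 1`.
  let t : ∀ p, K.X p →ₗ[MvPolynomial σ k] F.X p := fun p => s p ∘ₗ (e p).symm.toLinearMap
  have ht : ∀ p x, t p x = s p ((e p).symm x) := fun _ _ => rfl
  have htd : ∀ p x, F.d p (t (p + 1) x) = t p (K.d p x) := fun p x => by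
    rw [ht, ht, hsd, hesd]
  obtain ⟨H, hH0, hH⟩ := exists_homotopy hF.exact_succ
    (fun p => LinearMap.id - t p ∘ₗ π p)
    (fun p x => by
      change F.d p (x - t (p + 1) (π (p + 1) x)) = F.d p x - t p (π p (F.d p x))
      rw [map_sub, htd, hπd])
    (fun x => (hF.exact_zero _).1 (by
      change ε (x - t 0 (π 0 x)) = 0
      have : ε' ((e 0).symm (π 0 x)) = ε' (π 0 x) := by
        conv_rhs => rw [← he' 0 (π 0 x), hπε, hsε]
      rw [map_sub, ht, hsε, this, hπε, sub_self]))
  exact hrig.mem_smul_top I hI t π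
    (fun p m x hx => by
      have := hs p _ _ (hes p m x hx)
      rwa [add_zero] at this) hπ htd hπd he' H hH0 hH ψ hψ hψd hψψ p x

end FreeComplex

/-! ### The Koszul complex as a graded free resolution. -/

namespace Koszul

section Components

variable {R : Type*} [CommRing R] {n : ℕ}

/-- The component of homological degree `p` of an element of the exterior algebra. -/
def res (R : Type*) [CommRing R] (n p : ℕ) :
    (Finset (Fin n) → R) →ₗ[R] ({J : Finset (Fin n) // J.card = p} → R) :=
  LinearMap.funLeft R R Subtype.val

/-- The inclusion of the component of homological degree `p` in the exterior algebra. -/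
def ext (R : Type*) [CommRing R] (n p : ℕ) :
    ({J : Finset (Fin n) // J.card = p} → R) →ₗ[R] (Finset (Fin n) → R) where
  toFun x J := if h : J.card = p then x ⟨J, h⟩ else 0
  map_add' x y := by
    ext J
    by_cases h : J.card = p <;> simp [h]
  map_smul' c x := by
    ext J
    by_cases h : J.card = p <;> simp [h]

theorem res_apply (p : ℕ) (x : Finset (Fin n) → R) (J : {J : Finset (Fin n) // J.card = p}) :
    res R n p x J = x J.1 := rfl

theorem ext_apply (p : ℕ) (x : {J : Finset (Fin n) // J.card = p} → R) (J : Finset (Fin n)) :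
    ext R n p x J = if h : J.card = p then x ⟨J, h⟩ else 0 := rfl

theorem res_ext (p : ℕ) (x : {J : Finset (Fin n) // J.card = p} → R) :
    res R n p (ext R n p x) = x := by
  ext J
  rw [res_apply, ext_apply, dif_pos J.2]

theorem res_ext_ne {p q : ℕ} (h : q ≠ p) (x : {J : Finset (Fin n) // J.card = p} → R) :
    res R n q (ext R n p x) = 0 := by
  ext J
  rw [res_apply, ext_apply, dif_neg (by rw [J.2]; exact h)]
  rfl

/-- Coordinates at sets of size `p` of a contraction involve only sets of size `p + 1`. Computations
in the complex can therefore be done in the whole exterior algebra. -/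
theorem res_contr (p : ℕ) (i : Fin n) (x : Finset (Fin n) → R) :
    res R n p (contr R i (ext R n (p + 1) (res R n (p + 1) x))) = res R n p (contr R i x) := by
  ext J
  simp only [res_apply, contr_apply]
  by_cases h : i ∈ J.1
  · rw [if_pos h, if_pos h]
  · rw [if_neg h, if_neg h, ext_apply, dif_pos (by rw [Finset.card_insert_of_notMem h, J.2])]
    rfl

theorem res_diff (f : Fin n → R) (p : ℕ) (x : Finset (Fin n) → R) :
    res R n p (diff f (ext R n (p + 1) (res R n (p + 1) x))) = res R n p (diff f x) := by
  rw [diff_apply, diff_apply, map_sum, map_sum]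
  exact Finset.sum_congr rfl fun i _ => by rw [map_smul, map_smul, res_contr]

theorem diff_ext_eq_zero (f : Fin n → R) {p : ℕ} {x : {J : Finset (Fin n) // J.card = p + 1} → R}
    (hx : res R n p (diff f (ext R n (p + 1) x)) = 0) : diff f (ext R n (p + 1) x) = 0 := by
  ext J
  by_cases hJ : J.card = p
  · exact congrFun hx ⟨J, hJ⟩
  · rw [diff_apply, Finset.sum_apply]
    refine Finset.sum_eq_zero fun i _ => ?_
    rw [Pi.smul_apply, contr_apply]
    split_ifs with h
    · exact smul_zero _
    · rw [ext_apply, dif_neg (by rw [Finset.card_insert_of_notMem h]; omega), mul_zero, smul_zero]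

theorem res_succ_single (p : ℕ) (c : R) : res R n (p + 1) (Pi.single ∅ c) = 0 := by
  ext J
  have hJ : J.1 ≠ ∅ := fun h => by
    have := J.2
    rw [h, Finset.card_empty] at this
    omega
  rw [res_apply, Pi.single_eq_of_ne hJ]
  rfl

end Components

variable {k : Type u} [Field k] {n : ℕ}

/-- The grading of the exterior algebra on a free module with a basis in the degrees `d`. -/
abbrev grading (k : Type u) [Field k] {n : ℕ} (d : Fin n → ℕ) (m : ℤ) :
    AddSubgroup (Finset (Fin n) → MvPolynomial (Fin n) k) :=
  freeGrading k (Fin n) (fun J : Finset (Fin n) => ((∑ i ∈ J, d i : ℕ) : ℤ)) m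

/-- The induced grading of the component of homological degree `p`. -/
abbrev gradingComponent (k : Type u) [Field k] {n : ℕ} (d : Fin n → ℕ) (p : ℕ) (m : ℤ) :
    AddSubgroup ({J : Finset (Fin n) // J.card = p} → MvPolynomial (Fin n) k) :=
  freeGrading k (Fin n) (fun J : {J : Finset (Fin n) // J.card = p} =>
    ((∑ i ∈ J.1, d i : ℕ) : ℤ)) m

variable {d : Fin n → ℕ} {m : ℤ}

theorem res_mem (p : ℕ) {x : Finset (Fin n) → MvPolynomial (Fin n) k} (hx : x ∈ grading k d m) :
    res _ n p x ∈ gradingComponent k d p m := fun J => hx J.1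

theorem ext_mem (p : ℕ) {x : {J : Finset (Fin n) // J.card = p} → MvPolynomial (Fin n) k}
    (hx : x ∈ gradingComponent k d p m) : ext _ n p x ∈ grading k d m := by
  intro J
  rw [ext_apply]
  split_ifs with h
  · exact hx ⟨J, h⟩
  · exact zero_mem _

theorem contr_mem (i : Fin n) {x : Finset (Fin n) → MvPolynomial (Fin n) k}
    (hx : x ∈ grading k d m) : contr _ i x ∈ grading k d (m - d i) := by
  intro J
  rw [contr_apply]
  split_ifs with h
  · exact zero_mem _
  · have h1 := hx (insert i J)
    beta_reduce at h1
    rw [Finset.sum_insert h, Nat.cast_add, ← sub_sub] at h1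
    rcases neg_one_pow_eq_or (MvPolynomial (Fin n) k) (J.filter (· < i)).card with h2 | h2
    · rwa [sgn, h2, one_mul]
    · rw [sgn, h2, neg_one_mul]
      exact neg_mem h1

theorem smul_mem_grading {j : ℤ} {p : MvPolynomial (Fin n) k} (hp : p ∈ polyGrading k (Fin n) j)
    {x : Finset (Fin n) → MvPolynomial (Fin n) k} (hx : x ∈ grading k d m) :
    p • x ∈ grading k d (j + m) :=
  (isGrading_freeGrading _).smul_mem j m p x hp hx

theorem diff_mem {f : Fin n → MvPolynomial (Fin n) k} (hf : ∀ i, (f i).IsHomogeneous (d i))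
    {x : Finset (Fin n) → MvPolynomial (Fin n) k} (hx : x ∈ grading k d m) :
    diff f x ∈ grading k d m := by
  rw [diff_apply]
  refine sum_mem fun i _ => ?_
  have := smul_mem_grading (mem_polyGrading_natCast.2 (hf i)) (contr_mem i hx)
  rwa [add_sub_cancel] at this

end Koszul

namespace Koszul

variable {k : Type u} [Field k] {n : ℕ} {f : Fin n → MvPolynomial (Fin n) k} {d : Fin n → ℕ}

/-- The Koszul complex on a family of forms. -/
noncomputable def complex (f : Fin n → MvPolynomial (Fin n) k) (d : Fin n → ℕ)
    (hf : ∀ i, (f i).IsHomogeneous (d i)) : FreeComplex k (Fin n) where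
  X p := {J : Finset (Fin n) // J.card = p} → MvPolynomial (Fin n) k
  gr p := gradingComponent k d p
  isGradedFree p := isGradedFree_freeGrading _
  d p := res _ n p ∘ₗ diff f ∘ₗ ext _ n (p + 1)
  d_homogeneous p := fun m x hx => by
    rw [add_zero]
    exact res_mem p (diff_mem hf (ext_mem (p + 1) hx))
  d_comp_d p := LinearMap.ext fun x => by
    change res _ n p (diff f (ext _ n (p + 1) (res _ n (p + 1) (diff f (ext _ n (p + 2) x))))) = 0
    rw [res_diff, diff_diff, map_zero]

variable (hf : ∀ i, (f i).IsHomogeneous (d i))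

/-- The projection of the exterior algebra to a term of the Koszul complex. -/
noncomputable def toComplex (p : ℕ) :
    (Finset (Fin n) → MvPolynomial (Fin n) k) →ₗ[MvPolynomial (Fin n) k] (complex f d hf).X p :=
  res _ n p

/-- The inclusion of a term of the Koszul complex in the exterior algebra. -/
noncomputable def ofComplex (p : ℕ) :
    (complex f d hf).X p →ₗ[MvPolynomial (Fin n) k] (Finset (Fin n) → MvPolynomial (Fin n) k) :=
  ext _ n p

/-- The coordinates of a term of the Koszul complex. -/
noncomputable def coord (p : ℕ) (J : {J : Finset (Fin n) // J.card = p}) :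
    (complex f d hf).X p →ₗ[MvPolynomial (Fin n) k] MvPolynomial (Fin n) k :=
  LinearMap.proj (R := MvPolynomial (Fin n) k)
    (φ := fun _ : {J : Finset (Fin n) // J.card = p} => MvPolynomial (Fin n) k) J

theorem complex_ext {p : ℕ} {x y : (complex f d hf).X p}
    (h : ∀ J, coord hf p J x = coord hf p J y) : x = y :=
  funext h

theorem coord_toComplex (p : ℕ) (J : {J : Finset (Fin n) // J.card = p})
    (x : Finset (Fin n) → MvPolynomial (Fin n) k) : coord hf p J (toComplex hf p x) = x J.1 := rfl

theorem mem_gr_iff {p : ℕ} {m : ℤ} {x : (complex f d hf).X p} :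
    x ∈ (complex f d hf).gr p m ↔
      ∀ J, coord hf p J x ∈ polyGrading k (Fin n) (m - ((∑ i ∈ J.1, d i : ℕ) : ℤ)) := Iff.rfl

theorem toComplex_ofComplex (p : ℕ) (x : (complex f d hf).X p) :
    toComplex hf p (ofComplex hf p x) = x := res_ext p x

theorem toComplex_ofComplex_ne {p q : ℕ} (h : q ≠ p) (x : (complex f d hf).X p) :
    toComplex hf q (ofComplex hf p x) = 0 := res_ext_ne h x

theorem complex_d (p : ℕ) (x : (complex f d hf).X (p + 1)) :
    (complex f d hf).d p x = toComplex hf p (diff f (ofComplex hf (p + 1) x)) := rfl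

theorem complex_d_toComplex (p : ℕ) (x : Finset (Fin n) → MvPolynomial (Fin n) k) :
    (complex f d hf).d p (toComplex hf (p + 1) x) = toComplex hf p (diff f x) :=
  res_diff f p x

/-- The augmentation of the Koszul complex. -/
noncomputable def augmentation : (complex f d hf).X 0 →ₗ[MvPolynomial (Fin n) k]
    MvPolynomial (Fin n) k ⧸ Ideal.span (Set.range f) :=
  (Ideal.span (Set.range f)).mkQ ∘ₗ coord hf 0 ⟨∅, Finset.card_empty⟩

theorem augmentation_apply (x : (complex f d hf).X 0) :
    augmentation hf x = Ideal.Quotient.mk _ (coord hf 0 ⟨∅, Finset.card_empty⟩ x) := rfl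

theorem image_lt_eq_range (f : Fin n → MvPolynomial (Fin n) k) :
    f '' {i | (i : ℕ) < n} = Set.range f := by
  rw [← Set.image_univ]
  congr 1
  ext i
  simp

theorem mem_supp_card (x : Finset (Fin n) → MvPolynomial (Fin n) k) : x ∈ supp _ n n := by
  rintro J ⟨j, -, hj⟩
  exact absurd j.2 (by omega)

theorem mem_range_d_zero_iff (x : (complex f d hf).X 0) :
    x ∈ LinearMap.range ((complex f d hf).d 0) ↔
      coord hf 0 ⟨∅, Finset.card_empty⟩ x ∈ Ideal.span (Set.range f) := by
  constructor
  · rintro ⟨y, rfl⟩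
    have := diff_apply_empty_mem f (mem_supp_card (ofComplex hf 1 y))
    rwa [image_lt_eq_range] at this
  · intro hx
    rw [← image_lt_eq_range] at hx
    obtain ⟨v, -, hv⟩ := exists_diff_eq_single f hx
    refine ⟨toComplex hf 1 v, ?_⟩
    rw [complex_d_toComplex, hv]
    refine complex_ext hf fun J => ?_
    obtain ⟨J, hJ⟩ := J
    obtain rfl := Finset.card_eq_zero.1 hJ
    rw [coord_toComplex, Pi.single_eq_same]

theorem complex_exact (hreg : ∀ (r : Fin n) (c : MvPolynomial (Fin n) k),
    f r * c ∈ Ideal.span (f '' {i | (i : ℕ) < r}) → c ∈ Ideal.span (f '' {i | (i : ℕ) < r}))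
    (p : ℕ) : Function.Exact ((complex f d hf).d (p + 1)) ((complex f d hf).d p) := by
  intro z
  constructor
  · intro hz
    obtain ⟨w, -, c, hw⟩ := exists_eq_diff_add_single f hreg n le_rfl (ofComplex hf (p + 1) z)
      (mem_supp_card _) (diff_ext_eq_zero f hz)
    refine ⟨toComplex hf (p + 2) w, ?_⟩
    have h0 : toComplex hf (p + 1) (Pi.single ∅ c) = 0 := res_succ_single p c
    rw [complex_d_toComplex, ← toComplex_ofComplex hf (p + 1) z, hw, map_add, h0, add_zero]
  · rintro ⟨z, rfl⟩
    exact (complex f d hf).d_d p z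

theorem complex_isResolution (hreg : ∀ (r : Fin n) (c : MvPolynomial (Fin n) k),
    f r * c ∈ Ideal.span (f '' {i | (i : ℕ) < r}) → c ∈ Ideal.span (f '' {i | (i : ℕ) < r})) :
    (complex f d hf).IsResolution (quotientGrading (Ideal.span (Set.range f))) (augmentation hf)
    where
  homogeneous := by
    intro m x hx
    refine ⟨coord hf 0 ⟨∅, Finset.card_empty⟩ x, ?_, rfl⟩
    have := (mem_gr_iff hf).1 hx ⟨∅, Finset.card_empty⟩
    simpa using this
  surjective := by
    intro y
    obtain ⟨p, rfl⟩ := Ideal.Quotient.mk_surjective y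
    exact ⟨toComplex hf 0 fun _ => p, rfl⟩
  exact_zero := by
    intro z
    rw [augmentation_apply, Ideal.Quotient.eq_zero_iff_mem, ← mem_range_d_zero_iff]
    exact Iff.rfl
  exact_succ := complex_exact hf hreg

/-- The total module is a sum over all of `ℕ`, but there are no subsets of size greater than `n`.
Finiteness is needed to invert endomorphisms modulo `I` on both sides. -/
theorem finite_total : Module.Finite (MvPolynomial (Fin n) k) (complex f d hf).Total := by
  let g : (Finset (Fin n) → MvPolynomial (Fin n) k) →ₗ[MvPolynomial (Fin n) k]
      (complex f d hf).Total :=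
    ∑ p ∈ Finset.range (n + 1), (complex f d hf).inc p ∘ₗ toComplex hf p
  refine Module.Finite.of_surjective g fun x => ?_
  obtain ⟨s, hs⟩ := (complex f d hf).exists_eq_sum_inc x
  change x ∈ LinearMap.range g
  rw [hs]
  refine sum_mem fun p _ => ?_
  by_cases hp : p ∈ Finset.range (n + 1)
  · refine ⟨ofComplex hf p (x p), ?_⟩
    rw [LinearMap.sum_apply, Finset.sum_eq_single_of_mem p hp]
    · rw [LinearMap.comp_apply, toComplex_ofComplex]
    · intro q _ hq
      rw [LinearMap.comp_apply, toComplex_ofComplex_ne hf hq, map_zero]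
  · have h0 : x p = 0 := by
      refine complex_ext hf fun J => ?_
      have h1 := Finset.card_le_univ J.1
      rw [J.2, Fintype.card_fin] at h1
      exact absurd (Finset.mem_range.2 (by omega)) hp
    rw [h0, map_zero]
    exact zero_mem _

theorem complex_d_mem (p : ℕ) (x : (complex f d hf).X (p + 1)) :
    (complex f d hf).d p x ∈ Ideal.span (Set.range f) •
      (⊤ : Submodule (MvPolynomial (Fin n) k) ((complex f d hf).X p)) := by
  rw [complex_d, diff_apply, map_sum]
  refine sum_mem fun i _ => ?_
  rw [map_smul]
  exact Submodule.smul_mem_smul (Ideal.subset_span ⟨i, rfl⟩) Submodule.mem_top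

/-- The contraction of the Koszul complex with the form `g` times the product of two dual basis
vectors, with the signs that make it anticommute with the differential. -/
noncomputable def pairing (g : MvPolynomial (Fin n) k) (i j : Fin n) (p : ℕ) :
    (complex f d hf).X (p + 2) →ₗ[MvPolynomial (Fin n) k] (complex f d hf).X p :=
  ((-1) ^ p * g) • (toComplex hf p ∘ₗ contr _ i ∘ₗ contr _ j ∘ₗ ofComplex hf (p + 2))

theorem pairing_toComplex (g : MvPolynomial (Fin n) k) (i j : Fin n) (p : ℕ)
    (x : Finset (Fin n) → MvPolynomial (Fin n) k) :
    pairing hf g i j p (toComplex hf (p + 2) x) =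
      toComplex hf p (((-1) ^ p * g) • contr _ i (contr _ j x)) := by
  change ((-1) ^ p * g) • res _ n p (contr _ i (contr _ j (ext _ n (p + 2) (res _ n (p + 2) x)))) =
    res _ n p (((-1) ^ p * g) • contr _ i (contr _ j x))
  rw [map_smul, ← res_contr, res_contr (p + 1) j, res_contr]

theorem exists_eq_toComplex (p : ℕ) (x : (complex f d hf).X p) : ∃ y, x = toComplex hf p y :=
  ⟨ofComplex hf p x, (toComplex_ofComplex hf p x).symm⟩

/-- The two contractions lower the degree by `d i + d j` and `g` restores all but `a` of it. After
the twists in the fold this is a map of degree `a`. -/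
theorem pairing_isHomogeneousMap {a : ℤ} {g : MvPolynomial (Fin n) k} {i j : Fin n}
    (hg : g ∈ polyGrading k (Fin n) (d i + d j - a)) (p : ℕ) :
    IsHomogeneousMap ((complex f d hf).gr (p + 2)) ((complex f d hf).gr p) (-a)
      (pairing hf g i j p) := by
  intro m x hx
  have h0 : (-1) ^ p * g ∈ polyGrading k (Fin n) (d i + d j - a) := by
    rcases neg_one_pow_eq_or (MvPolynomial (Fin n) k) p with h | h
    · rwa [h, one_mul]
    · rw [h, neg_one_mul]
      exact neg_mem hg
  have h1 := res_mem p (smul_mem_grading h0 (contr_mem i (contr_mem j (ext_mem (p + 2) hx))))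
  rw [map_smul, show (d i : ℤ) + d j - a + (m - d j - d i) = m + -a by ring] at h1
  exact h1

/-- Each contraction anticommutes with the differential, so two of them commute with it; the
alternating factor `(-1) ^ p` turns this into anticommutation. -/
theorem complex_d_pairing (g : MvPolynomial (Fin n) k) (i j : Fin n) (p : ℕ)
    (x : (complex f d hf).X (p + 3)) :
    (complex f d hf).d p (pairing hf g i j (p + 1) x) +
      pairing hf g i j p ((complex f d hf).d (p + 2) x) = 0 := by
  obtain ⟨x, rfl⟩ := exists_eq_toComplex hf (p + 3) x
  rw [complex_d_toComplex, pairing_toComplex, complex_d_toComplex, pairing_toComplex, ← map_add, map_smul,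
    diff_contr, diff_contr, map_neg, neg_neg, pow_succ, ← add_smul]
  simp

theorem pairing_pairing (g : MvPolynomial (Fin n) k) (i j : Fin n) (p : ℕ)
    (x : (complex f d hf).X (p + 4)) :
    pairing hf g i j p (pairing hf g i j (p + 2) x) = 0 := by
  obtain ⟨x, rfl⟩ := exists_eq_toComplex hf (p + 4) x
  rw [pairing_toComplex, pairing_toComplex, map_smul, map_smul, contr_contr j i,
    contr_contr_self, map_zero, neg_zero, smul_zero, map_zero, map_zero, smul_zero]

theorem contr_contr_wedge_wedge {i j : Fin n} (hij : i ≠ j) (c : MvPolynomial (Fin n) k) :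
    contr _ i (contr _ j (wedge _ j (wedge _ i (Pi.single ∅ c)))) =
      (Pi.single ∅ c : Finset (Fin n) → MvPolynomial (Fin n) k) := by
  have h1 := contr_wedge_self j (wedge _ i (Pi.single ∅ c))
  rw [contr_wedge hij.symm, contr_single, map_zero, neg_zero, map_zero, add_zero] at h1
  have h2 := contr_wedge_self (R := MvPolynomial (Fin n) k) i (Pi.single ∅ c)
  rw [contr_single, map_zero, add_zero] at h2
  rw [h1, h2]

theorem isInternal_quotientGrading_span (hf : ∀ i, (f i).IsHomogeneous (d i)) :
    DirectSum.IsInternal (quotientGrading (Ideal.span (Set.range f))) :=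
  isInternal_quotientGrading _ fun _ hp m =>
    proj_mem_span (d := fun i => (d i : ℤ)) (fun i => mem_polyGrading_natCast.2 (hf i)) hp m

/-- If a resolution of the complete intersection is `a`-rigid, then the ideal contains all forms of
degree `d i + d j - a`. -/
theorem mem_span_of_isRigid (hf : ∀ i, (f i).IsHomogeneous (d i))
    (hreg : ∀ (r : Fin n) (c : MvPolynomial (Fin n) k),
      f r * c ∈ Ideal.span (f '' {i | (i : ℕ) < r}) → c ∈ Ideal.span (f '' {i | (i : ℕ) < r}))
    (htop : Ideal.span (Set.range f) ≠ ⊤) {a : ℤ} {F : FreeComplex k (Fin n)}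
    {ε : F.X 0 →ₗ[MvPolynomial (Fin n) k] MvPolynomial (Fin n) k ⧸ Ideal.span (Set.range f)}
    (hF : F.IsResolution (quotientGrading (Ideal.span (Set.range f))) ε) (hrig : F.IsRigid a)
    {i j : Fin n} (hij : i ≠ j) {g : MvPolynomial (Fin n) k}
    (hg : g ∈ polyGrading k (Fin n) (d i + d j - a)) : g ∈ Ideal.span (Set.range f) := by
  have : Module.Finite (MvPolynomial (Fin n) k) (complex f d hf).Total := finite_total hf
  -- The test element is the wedge of the basis vectors `j` and `i`, on which the contraction takes
  -- the value `g`.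
  have key := FreeComplex.IsResolution.mem_smul_top_of_isRigid (isInternal_quotientGrading_span hf)
    hF (complex_isResolution hf hreg) hrig (Ideal.span (Set.range f)) (complex_d_mem hf)
    (fun p v hv hvI => bijective_of_sub_mem_smul_top
      (fun J : {J : Finset (Fin n) // J.card = p} => ∑ i ∈ J.1, d i) htop v hv hvI)
    (pairing hf g i j) (pairing_isHomogeneousMap hf hg) (complex_d_pairing hf g i j)
    (pairing_pairing hf g i j) 0 (toComplex hf 2 (wedge _ j (wedge _ i (Pi.single ∅ 1))))
  rw [pairing_toComplex, contr_contr_wedge_wedge hij] at key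
  have := map_mem_smul_top _ (coord hf 0 ⟨∅, Finset.card_empty⟩) key
  rw [smul_eq_mul, Ideal.mul_top, coord_toComplex] at this
  simpa using this

/-- The Koszul complex is `a`-rigid if for all sets `J` of at least two indices the ideal contains
all forms of degree `∑ i ∈ J, d i - (#J - 1) a`. -/
theorem complex_isRigid
    (hreg : ∀ (r : Fin n) (c : MvPolynomial (Fin n) k),
      f r * c ∈ Ideal.span (f '' {i | (i : ℕ) < r}) → c ∈ Ideal.span (f '' {i | (i : ℕ) < r}))
    (a : ℤ) (hobs : ∀ J : Finset (Fin n), 2 ≤ J.card →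
      ∀ g ∈ polyGrading k (Fin n) (∑ i ∈ J, (d i : ℤ) - (J.card - 1) * a),
        g ∈ Ideal.span (Set.range f)) : (complex f d hf).IsRigid a := by
  refine FreeComplex.isRigid_of_forall_mem_range (complex f d hf) a (complex_exact hf hreg)
    (ι := fun p => {J : Finset (Fin n) // J.card = p})
    (fun p => Pi.basisFun (MvPolynomial (Fin n) k) {J : Finset (Fin n) // J.card = p})
    (fun p J => ((∑ i ∈ J.1, d i : ℕ) : ℤ)) (fun p J => basisFun_mem_freeGrading _ J)
    fun p J z hz => ?_
  rw [mem_range_d_zero_iff]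
  refine hobs J.1 (by rw [J.2]; omega) _ ?_
  have := (mem_gr_iff hf).1 hz ⟨∅, Finset.card_empty⟩
  rw [J.2]
  convert this using 2
  rw [Finset.sum_empty]
  push_cast
  ring

end Koszul

/-! ### Hilbert functions of complete intersections. -/

section Hilbert

variable {k : Type u} [Field k] {n : ℕ}

/-- The forms of degree `m`, as a vector space. -/
noncomputable def formSpace (k : Type u) [Field k] (n : ℕ) (m : ℤ) :
    Submodule k (MvPolynomial (Fin n) k) where
  toAddSubmonoid := (polyGrading k (Fin n) m).toAddSubmonoid
  smul_mem' c p hp := by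
    rw [MvPolynomial.smul_eq_C_mul]
    have := mul_mem_polyGrading (C_mem_polyGrading (σ := Fin n) c) hp
    rwa [zero_add] at this

theorem mem_formSpace {m : ℤ} {p : MvPolynomial (Fin n) k} :
    p ∈ formSpace k n m ↔ p ∈ polyGrading k (Fin n) m := Iff.rfl

theorem formSpace_natCast (t : ℕ) :
    formSpace k n t = MvPolynomial.homogeneousSubmodule (Fin n) k t := by
  ext p
  exact mem_polyGrading_natCast

theorem formSpace_of_neg {m : ℤ} (hm : m < 0) : formSpace k n m = ⊥ :=
  eq_bot_iff.2 fun _ hp => eq_zero_of_mem_polyGrading_of_neg hm hp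

instance finiteDimensional_formSpace (m : ℤ) : FiniteDimensional k (formSpace k n m) := by
  rcases lt_or_ge m 0 with hm | hm
  · rw [formSpace_of_neg hm]
    infer_instance
  · lift m to ℕ using hm
    rw [formSpace_natCast]
    exact Module.Finite.of_fg (MvPolynomial.homogeneousSubmodule_fg (Fin n) k m)

theorem finrank_formSpace (t : ℕ) :
    Module.finrank k (formSpace k n t) = (n + t - 1).choose t := by
  classical
  let b : (Finset.univ : Finset (Fin n)).finsuppAntidiag t → MvPolynomial (Fin n) k :=
    fun e => MvPolynomial.basisMonomials (Fin n) k e.1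
  have hb : LinearIndependent k b :=
    (MvPolynomial.basisMonomials (Fin n) k).linearIndependent.comp _ Subtype.val_injective
  have hdeg : ∀ e : Fin n →₀ ℕ, e ∈ (Finset.univ : Finset (Fin n)).finsuppAntidiag t ↔
      e.degree = t := by
    intro e
    rw [Finset.mem_finsuppAntidiag, Finsupp.degree_eq_sum]
    simp
  have hspan : formSpace k n t = Submodule.span k (Set.range b) := by
    apply le_antisymm
    · intro p hp
      rw [p.as_sum]
      refine sum_mem fun e he => ?_
      have h1 : e.degree = t := by exact_mod_cast hp e (MvPolynomial.mem_support_iff.1 he)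
      have h2 : MvPolynomial.monomial e (p.coeff e) = p.coeff e • b ⟨e, (hdeg e).2 h1⟩ := by
        simp [b, MvPolynomial.smul_monomial]
      rw [h2]
      exact Submodule.smul_mem _ _ (Submodule.subset_span ⟨_, rfl⟩)
    · rw [Submodule.span_le]
      rintro _ ⟨e, rfl⟩
      rw [formSpace_natCast]
      simp only [b, MvPolynomial.coe_basisMonomials]
      exact MvPolynomial.isHomogeneous_monomial 1 ((hdeg e.1).1 e.2)
  rw [hspan, finrank_span_eq_card hb, Fintype.card_coe, Finset.card_finsuppAntidiag_nat_eq_choose,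
    Finset.card_univ, Fintype.card_fin]

/-- The forms of degree `m` in an ideal. -/
noncomputable def formsIn (J : Ideal (MvPolynomial (Fin n) k)) (m : ℤ) :
    Submodule k (MvPolynomial (Fin n) k) :=
  J.restrictScalars k ⊓ formSpace k n m

theorem mem_formsIn {J : Ideal (MvPolynomial (Fin n) k)} {m : ℤ} {p : MvPolynomial (Fin n) k} :
    p ∈ formsIn J m ↔ p ∈ J ∧ p ∈ polyGrading k (Fin n) m := Iff.rfl

theorem formsIn_le (J : Ideal (MvPolynomial (Fin n) k)) (m : ℤ) : formsIn J m ≤ formSpace k n m :=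
  inf_le_right

instance finiteDimensional_formsIn (J : Ideal (MvPolynomial (Fin n) k)) (m : ℤ) :
    FiniteDimensional k (formsIn J m) :=
  Submodule.finiteDimensional_of_le (formsIn_le J m)

/-- The Hilbert function of the quotient by an ideal. -/
noncomputable def hilbert (J : Ideal (MvPolynomial (Fin n) k)) (m : ℤ) : ℤ :=
  Module.finrank k (formSpace k n m) - Module.finrank k (formsIn J m)

theorem hilbert_of_neg (J : Ideal (MvPolynomial (Fin n) k)) {m : ℤ} (hm : m < 0) :
    hilbert J m = 0 := by
  have h : formsIn J m = ⊥ := eq_bot_iff.2 ((formsIn_le J m).trans (formSpace_of_neg hm).le)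
  rw [hilbert, h, formSpace_of_neg hm, sub_self]

theorem hilbert_bot (m : ℤ) :
    hilbert (⊥ : Ideal (MvPolynomial (Fin n) k)) m = Module.finrank k (formSpace k n m) := by
  have h : formsIn (⊥ : Ideal (MvPolynomial (Fin n) k)) m = ⊥ :=
    eq_bot_iff.2 fun p hp => (mem_formsIn.1 hp).1
  rw [hilbert, h, finrank_bot, Nat.cast_zero, sub_zero]

theorem mem_of_hilbert_eq_zero {J : Ideal (MvPolynomial (Fin n) k)} {m : ℤ} (h : hilbert J m = 0)
    {p : MvPolynomial (Fin n) k} (hp : p ∈ polyGrading k (Fin n) m) : p ∈ J := by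
  have heq : formsIn J m = formSpace k n m := by
    refine Submodule.eq_of_le_of_finrank_eq (formsIn_le J m) ?_
    rw [hilbert, sub_eq_zero] at h
    exact_mod_cast h.symm
  have h1 : p ∈ formsIn J m := heq ▸ mem_formSpace.2 hp
  exact (mem_formsIn.1 h1).1

theorem exists_notMem_of_hilbert_ne_zero {J : Ideal (MvPolynomial (Fin n) k)} {m : ℤ}
    (h : hilbert J m ≠ 0) : ∃ p ∈ polyGrading k (Fin n) m, p ∉ J := by
  by_contra! hcon
  have heq : formsIn J m = formSpace k n m :=
    le_antisymm (formsIn_le J m) fun p hp => mem_formsIn.2 ⟨hcon p hp, hp⟩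
  rw [hilbert, heq, sub_self] at h
  exact h rfl

/-- The Hilbert function of the quotient by one more form that is a nonzerodivisor. -/
theorem hilbert_sup_span {J : Ideal (MvPolynomial (Fin n) k)}
    (hJ : ∀ p ∈ J, ∀ m, proj isInternal_polyGrading m p ∈ J) (hJtop : J ≠ ⊤)
    {g : MvPolynomial (Fin n) k} {e : ℤ} (hg : g ∈ polyGrading k (Fin n) e)
    (hreg : ∀ c, g * c ∈ J → c ∈ J) (m : ℤ) :
    hilbert (J ⊔ Ideal.span {g}) m = hilbert J m - hilbert J (m - e) := by
  have hg0 : g ≠ 0 := by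
    rintro rfl
    exact hJtop ((Ideal.eq_top_iff_one J).2 (hreg 1 (by rw [zero_mul]; exact zero_mem J)))
  let μ : MvPolynomial (Fin n) k →ₗ[k] MvPolynomial (Fin n) k := LinearMap.mulLeft k g
  have hμ : Function.Injective μ := fun x y hxy => mul_left_cancel₀ hg0 hxy
  have hrank : ∀ A : Submodule k (MvPolynomial (Fin n) k),
      Module.finrank k (A.map μ) = Module.finrank k A := fun A =>
    (Submodule.equivMapOfInjective μ hμ A).finrank_eq.symm
  have hmul : ∀ c ∈ polyGrading k (Fin n) (m - e), g * c ∈ polyGrading k (Fin n) m := by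
    intro c hc
    have := mul_mem_polyGrading hg hc
    rwa [add_sub_cancel] at this
  -- The dimension count: the new degree `m` piece is `J_m + g S_{m-e}`, and `J_m ∩ g S_{m-e} = g
  -- J_{m-e}` because `g` is a nonzerodivisor modulo `J`.
  have hsup : formsIn (J ⊔ Ideal.span {g}) m = formsIn J m ⊔ (formSpace k n (m - e)).map μ := by
    apply le_antisymm
    · intro p hp
      obtain ⟨hp1, hp2⟩ := mem_formsIn.1 hp
      obtain ⟨x, hx, y, hy, rfl⟩ := Submodule.mem_sup.1 hp1
      obtain ⟨c, rfl⟩ := Ideal.mem_span_singleton'.1 hy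
      rw [← proj_of_mem_same isInternal_polyGrading hp2, map_add]
      refine Submodule.add_mem_sup (mem_formsIn.2 ⟨hJ x hx m, proj_mem _ _ _⟩) ?_
      refine ⟨proj isInternal_polyGrading (m - e) c, proj_mem isInternal_polyGrading _ _, ?_⟩
      rw [← smul_eq_mul, proj_smul isGrading_polyGrading c hg, smul_eq_mul, mul_comm]
      rfl
    · refine sup_le (fun p hp => ?_) ?_
      · exact mem_formsIn.2 ⟨Ideal.mem_sup_left (mem_formsIn.1 hp).1, (mem_formsIn.1 hp).2⟩
      · rintro _ ⟨c, hc, rfl⟩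
        exact mem_formsIn.2 ⟨Ideal.mem_sup_right (Ideal.mul_mem_right c _
          (Ideal.mem_span_singleton_self g)), hmul c hc⟩
  have hinf : formsIn J m ⊓ (formSpace k n (m - e)).map μ = (formsIn J (m - e)).map μ := by
    apply le_antisymm
    · rintro _ ⟨hp, c, hc, rfl⟩
      exact ⟨c, mem_formsIn.2 ⟨hreg c (mem_formsIn.1 hp).1, hc⟩, rfl⟩
    · rintro _ ⟨c, hc, rfl⟩
      obtain ⟨hc1, hc2⟩ := mem_formsIn.1 hc
      exact ⟨mem_formsIn.2 ⟨Ideal.mul_mem_left _ g hc1, hmul c hc2⟩, c, hc2, rfl⟩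
  have key := Submodule.finrank_sup_add_finrank_inf_eq (formsIn J m)
    ((formSpace k n (m - e)).map μ)
  rw [hinf, ← hsup, hrank, hrank] at key
  unfold hilbert
  have key' : (Module.finrank k (formsIn (J ⊔ Ideal.span {g}) m) : ℤ) +
      Module.finrank k (formsIn J (m - e)) =
      Module.finrank k (formsIn J m) + Module.finrank k (formSpace k n (m - e)) := by
    exact_mod_cast key
  linarith

/-- The power series has positive coefficients up to the degree `s` and is zero above. -/
def IsPositiveUpTo (P : PowerSeries ℤ) (s : ℕ) : Prop :=
  (∀ t ≤ s, 0 < P.coeff t) ∧ ∀ t, s < t → P.coeff t = 0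

theorem isPositiveUpTo_one : IsPositiveUpTo 1 0 := by
  refine ⟨fun t ht => ?_, fun t ht => ?_⟩
  · obtain rfl := Nat.le_zero.1 ht
    simp
  · rw [PowerSeries.coeff_one, if_neg (by omega)]

theorem IsPositiveUpTo.mul_geom_sum {P : PowerSeries ℤ} {s : ℕ} (h : IsPositiveUpTo P s) {e : ℕ}
    (he : 1 ≤ e) :
    IsPositiveUpTo (P * ∑ i ∈ Finset.range e, PowerSeries.X ^ i) (s + (e - 1)) := by
  have hc : ∀ t, (P * ∑ i ∈ Finset.range e, PowerSeries.X ^ i).coeff t =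
      ∑ i ∈ Finset.range e, if i ≤ t then P.coeff (t - i) else 0 := by
    intro t
    rw [Finset.mul_sum, map_sum]
    exact Finset.sum_congr rfl fun i _ => PowerSeries.coeff_mul_X_pow' _ _ _
  refine ⟨fun t ht => ?_, fun t ht => ?_⟩
  · rw [hc]
    -- The coefficient at `t` sums `P` over a window of length `e` ending at `t`. The index `min t
    -- (e - 1)` picks its lowest entry, which is at most `s` when `t ≤ s + (e - 1)`.
    refine Finset.sum_pos' (fun i _ => ?_) ⟨min t (e - 1), Finset.mem_range.2 (by omega), ?_⟩
    · split_ifs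
      · rcases le_or_gt (t - i) s with h1 | h1
        · exact (h.1 _ h1).le
        · exact (h.2 _ h1).ge
      · exact le_rfl
    · rw [if_pos (min_le_left _ _)]
      exact h.1 _ (by omega)
  · rw [hc]
    refine Finset.sum_eq_zero fun i hi => ?_
    have := Finset.mem_range.1 hi
    split_ifs
    · exact h.2 _ (by omega)
    · rfl

variable {f : Fin n → MvPolynomial (Fin n) k} {d : Fin n → ℕ}

theorem filter_lt_succ {r : ℕ} (hr : r < n) :
    Finset.univ.filter (fun i : Fin n => (i : ℕ) < r + 1) =
      insert ⟨r, hr⟩ (Finset.univ.filter fun i : Fin n => (i : ℕ) < r) := by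
  ext i
  simp only [Finset.mem_filter, Finset.mem_univ, true_and, Finset.mem_insert, Fin.ext_iff]
  omega

theorem span_image_lt_succ (f : Fin n → MvPolynomial (Fin n) k) {r : ℕ} (hr : r < n) :
    Ideal.span (f '' {i | (i : ℕ) < r + 1}) =
      Ideal.span (f '' {i | (i : ℕ) < r}) ⊔ Ideal.span {f ⟨r, hr⟩} := by
  rw [← Ideal.span_union, ← Set.image_singleton, ← Set.image_union]
  congr 2
  ext i
  simp only [Set.mem_ofPred_eq, Set.mem_union, Set.mem_singleton_iff, Fin.ext_iff]
  omega

/-- The Hilbert series of the quotients by the initial segments of a regular sequence of forms. -/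
theorem exists_hilbert_series (hf : ∀ i, (f i).IsHomogeneous (d i)) (hd : ∀ i, 1 ≤ d i)
    (hreg : ∀ (r : Fin n) (c : MvPolynomial (Fin n) k),
      f r * c ∈ Ideal.span (f '' {i | (i : ℕ) < r}) → c ∈ Ideal.span (f '' {i | (i : ℕ) < r}))
    (htop : Ideal.span (Set.range f) ≠ ⊤) (r : ℕ) (hr : r ≤ n) :
    ∃ G : PowerSeries ℤ,
      IsPositiveUpTo G (∑ i ∈ Finset.univ.filter (fun i : Fin n => (i : ℕ) < r), (d i - 1)) ∧
      PowerSeries.mk (fun t : ℕ => hilbert (Ideal.span (f '' {i | (i : ℕ) < r})) (t : ℤ)) =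
        PowerSeries.mk (fun t : ℕ => hilbert (⊥ : Ideal (MvPolynomial (Fin n) k)) (t : ℤ)) *
          (1 - PowerSeries.X) ^ r * G := by
  induction r with
  | zero => exact ⟨1, by simpa using isPositiveUpTo_one, by simp⟩
  | succ r ih =>
    obtain ⟨G, hG, hQ⟩ := ih (Nat.le_of_succ_le hr)
    have hr' : r < n := hr
    refine ⟨G * ∑ i ∈ Finset.range (d ⟨r, hr'⟩), PowerSeries.X ^ i, ?_, ?_⟩
    · rw [filter_lt_succ hr', Finset.sum_insert (by simp), add_comm]
      exact hG.mul_geom_sum (hd _)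
    · have hJ : ∀ p ∈ Ideal.span (f '' {i | (i : ℕ) < r}), ∀ m,
          proj isInternal_polyGrading m p ∈ Ideal.span (f '' {i | (i : ℕ) < r}) := by
        intro p hp m
        rw [Set.image_eq_range] at hp ⊢
        exact proj_mem_span (d := fun i => (d i.1 : ℤ))
          (fun i => mem_polyGrading_natCast.2 (hf i.1)) hp m
      have hJtop : Ideal.span (f '' {i | (i : ℕ) < r}) ≠ ⊤ := fun h => htop
        (top_le_iff.1 (h ▸ Ideal.span_mono (Set.image_subset_range _ _)))
      -- One more regular form multiplies the series by `1 - X ^ d r`, that is, by `1 - X` times a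
      -- geometric sum, which is absorbed in `G`.
      have hstep : PowerSeries.mk
          (fun t : ℕ => hilbert (Ideal.span (f '' {i | (i : ℕ) < r + 1})) (t : ℤ)) =
          PowerSeries.mk (fun t : ℕ => hilbert (Ideal.span (f '' {i | (i : ℕ) < r})) (t : ℤ)) *
            (1 - PowerSeries.X ^ d ⟨r, hr'⟩) := by
        ext t
        rw [mul_sub, mul_one, map_sub, PowerSeries.coeff_mul_X_pow', PowerSeries.coeff_mk,
          PowerSeries.coeff_mk, PowerSeries.coeff_mk, span_image_lt_succ f hr',
          hilbert_sup_span hJ hJtop (mem_polyGrading_natCast.2 (hf ⟨r, hr'⟩)) (hreg ⟨r, hr'⟩)]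
        split_ifs with h
        · rw [Nat.cast_sub h]
        · rw [hilbert_of_neg _ (by omega : (t : ℤ) - d ⟨r, hr'⟩ < 0)]
      rw [hstep, hQ, ← geom_sum_mul_neg]
      ring

theorem hilbert_series_bot (hn : 1 ≤ n) :
    PowerSeries.mk (fun t : ℕ => hilbert (⊥ : Ideal (MvPolynomial (Fin n) k)) (t : ℤ)) *
      (1 - PowerSeries.X) ^ n = 1 := by
  obtain ⟨N, rfl⟩ := Nat.exists_eq_add_of_le' hn
  refine Eq.trans ?_ (PowerSeries.mk_add_choose_mul_one_sub_pow_eq_one ℤ N)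
  congr 2
  funext t
  rw [hilbert_bot, finrank_formSpace, show N + 1 + t - 1 = N + t by omega,
    Nat.choose_symm_add]

theorem exists_hilbert_isPositiveUpTo (hn : 1 ≤ n) (hf : ∀ i, (f i).IsHomogeneous (d i))
    (hd : ∀ i, 1 ≤ d i)
    (hreg : ∀ (r : Fin n) (c : MvPolynomial (Fin n) k),
      f r * c ∈ Ideal.span (f '' {i | (i : ℕ) < r}) → c ∈ Ideal.span (f '' {i | (i : ℕ) < r}))
    (htop : Ideal.span (Set.range f) ≠ ⊤) :
    IsPositiveUpTo (PowerSeries.mk fun t : ℕ => hilbert (Ideal.span (Set.range f)) (t : ℤ))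
      (∑ i, (d i - 1)) := by
  obtain ⟨G, hG, hQ⟩ := exists_hilbert_series hf hd hreg htop n le_rfl
  rw [Koszul.image_lt_eq_range, hilbert_series_bot hn, one_mul] at hQ
  rw [hQ]
  convert hG using 1
  simp

/-- The socle degree of a graded complete intersection: the ideal contains all forms of larger
degree. -/
theorem mem_span_of_lt (hn : 1 ≤ n) (hf : ∀ i, (f i).IsHomogeneous (d i))
    (hd : ∀ i, 1 ≤ d i)
    (hreg : ∀ (r : Fin n) (c : MvPolynomial (Fin n) k),
      f r * c ∈ Ideal.span (f '' {i | (i : ℕ) < r}) → c ∈ Ideal.span (f '' {i | (i : ℕ) < r}))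
    (htop : Ideal.span (Set.range f) ≠ ⊤) {m : ℤ} (hm : ∑ i, (d i : ℤ) - n < m)
    {p : MvPolynomial (Fin n) k} (hp : p ∈ polyGrading k (Fin n) m) :
    p ∈ Ideal.span (Set.range f) := by
  rcases lt_or_ge m 0 with h0 | h0
  · rw [eq_zero_of_mem_polyGrading_of_neg h0 hp]
    exact zero_mem _
  · lift m to ℕ using h0
    have h := (exists_hilbert_isPositiveUpTo hn hf hd hreg htop).2 m (by
      zify
      rw [Finset.sum_congr rfl fun i _ => Nat.cast_sub (hd i), Finset.sum_sub_distrib]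
      simpa using hm)
    rw [PowerSeries.coeff_mk] at h
    exact mem_of_hilbert_eq_zero h hp

/-- Up to the socle degree there are forms outside of the ideal of a graded complete
intersection. -/
theorem exists_notMem_span_of_le (hn : 1 ≤ n) (hf : ∀ i, (f i).IsHomogeneous (d i))
    (hd : ∀ i, 1 ≤ d i)
    (hreg : ∀ (r : Fin n) (c : MvPolynomial (Fin n) k),
      f r * c ∈ Ideal.span (f '' {i | (i : ℕ) < r}) → c ∈ Ideal.span (f '' {i | (i : ℕ) < r}))
    (htop : Ideal.span (Set.range f) ≠ ⊤) {m : ℤ} (h0 : 0 ≤ m) (hm : m ≤ ∑ i, (d i : ℤ) - n) :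
    ∃ p ∈ polyGrading k (Fin n) m, p ∉ Ideal.span (Set.range f) := by
  lift m to ℕ using h0
  have h := (exists_hilbert_isPositiveUpTo hn hf hd hreg htop).1 m (by
    zify
    rw [Finset.sum_congr rfl fun i _ => Nat.cast_sub (hd i), Finset.sum_sub_distrib]
    simpa using hm)
  rw [PowerSeries.coeff_mk] at h
  exact exists_notMem_of_hilbert_ne_zero h.ne'

end Hilbert

/-! ### Which obstruction degrees fall in the range of `S/I`. -/

section Numerics

variable {n : ℕ} {d : Fin n → ℕ}

theorem card_le_sum_degrees (hd1 : ∀ i, 1 ≤ d i) (A : Finset (Fin n)) :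
    (A.card : ℤ) ≤ ∑ i ∈ A, (d i : ℤ) := by
  have := Finset.card_nsmul_le_sum A (fun i => (d i : ℤ)) 1 fun i _ => by exact_mod_cast hd1 i
  simpa using this

theorem sum_sub_one_le (hd1 : ∀ i, 1 ≤ d i) (A : Finset (Fin n)) :
    ∑ i ∈ A, (d i : ℤ) - A.card ≤ ∑ i, (d i : ℤ) - n := by
  have h1 := card_le_sum_degrees hd1 Aᶜ
  have h2 := Finset.sum_add_sum_compl A fun i => (d i : ℤ)
  have h3 := Finset.card_add_card_compl A
  rw [Fintype.card_fin] at h3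
  have h4 : (A.card : ℤ) + Aᶜ.card = n := by exact_mod_cast h3
  linarith

/-- Some pair of degrees lies within the socle degree above a value of `a` in the interval of non-rigidity. -/
theorem exists_pair (h₀ : 0 < n) (h₁ : 1 < n) (h₂ : n - 2 < n) (h₃ : n - 1 < n)
    (hd1 : ∀ i, 1 ≤ d i) {a : ℤ}
    (h1 : (d ⟨0, h₀⟩ : ℤ) + d ⟨1, h₁⟩ + n - ∑ i, (d i : ℤ) ≤ a)
    (h2 : a ≤ (d ⟨n - 2, h₂⟩ : ℤ) + d ⟨n - 1, h₃⟩) :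
    ∃ i j : Fin n, i ≠ j ∧ 0 ≤ (d i : ℤ) + d j - a ∧
      (d i : ℤ) + d j - a ≤ ∑ i, (d i : ℤ) - n := by
  have hs : ∀ i, (d i : ℤ) - 1 ≤ ∑ i, (d i : ℤ) - n := fun i => by
    simpa using sum_sub_one_le hd1 {i}
  -- The pairs (first, second), (first, last), (last but one, last) serve successive ranges of `a`.
  -- In the last two ranges, failure of the preceding bound gives `d i + d j - a ≤ d l - 1` for a
  -- single `l`, which is within the socle degree.
  rcases le_or_gt a (d ⟨0, h₀⟩ + d ⟨1, h₁⟩) with h3 | h3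
  · exact ⟨⟨0, h₀⟩, ⟨1, h₁⟩, by simp, by linarith, by linarith⟩
  rcases le_or_gt a (d ⟨0, h₀⟩ + d ⟨n - 1, h₃⟩) with h4 | h4
  · refine ⟨⟨0, h₀⟩, ⟨n - 1, h₃⟩, ?_, by linarith, ?_⟩
    · rw [Ne, Fin.mk.injEq]
      omega
    · have := hs ⟨n - 1, h₃⟩
      have := hd1 ⟨1, h₁⟩
      zify at this
      linarith
  · refine ⟨⟨n - 2, h₂⟩, ⟨n - 1, h₃⟩, ?_, by linarith, ?_⟩
    · rw [Ne, Fin.mk.injEq]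
      omega
    · have := hs ⟨n - 2, h₂⟩
      have := hd1 ⟨0, h₀⟩
      zify at this
      linarith

/-- The largest index contributes at most `d_n` and each other index at most `d_{n-1}`; since `#J -
1 ≥ 1`, enlarging the coefficient of `d_n` from `1` to `#J - 1` loses nothing. -/
theorem sum_le_of_two_le_card (h₂ : n - 2 < n) (h₃ : n - 1 < n) (hd : Monotone d)
    {J : Finset (Fin n)} (hJ : 2 ≤ J.card) :
    ∑ i ∈ J, (d i : ℤ) ≤
      (J.card - 1) * ((d ⟨n - 2, h₂⟩ : ℤ) + d ⟨n - 1, h₃⟩) := by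
  have hne : J.Nonempty := Finset.card_pos.1 (by omega)
  set t := J.max' hne with ht
  have htJ : t ∈ J := J.max'_mem hne
  have h1 : (d t : ℤ) ≤ d ⟨n - 1, h₃⟩ := by
    have h : t ≤ ⟨n - 1, h₃⟩ := Fin.le_def.2 (by change (t : ℕ) ≤ n - 1; omega)
    exact_mod_cast hd h
  have h2 : ∑ i ∈ J.erase t, (d i : ℤ) ≤ (J.erase t).card • (d ⟨n - 2, h₂⟩ : ℤ) := by
    refine Finset.sum_le_card_nsmul _ _ _ fun i hi => ?_
    have hit := J.le_max' i (Finset.mem_of_mem_erase hi)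
    have hne := Finset.ne_of_mem_erase hi
    have hlt : (i : ℕ) < t := lt_of_le_of_ne hit fun h => hne (Fin.ext h)
    have htn := t.2
    have h : i ≤ ⟨n - 2, h₂⟩ := Fin.le_def.2 (by change (i : ℕ) ≤ n - 2; omega)
    exact_mod_cast hd h
  rw [Finset.card_erase_of_mem htJ, nsmul_eq_mul, Nat.cast_sub (by omega), Nat.cast_one] at h2
  rw [← Finset.add_sum_erase J _ htJ]
  have h3 : (0 : ℤ) ≤ ((J.card : ℤ) - 2) * d ⟨n - 1, h₃⟩ :=
    mul_nonneg (by have : (2 : ℤ) ≤ J.card := by exact_mod_cast hJ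
                   linarith) (Nat.cast_nonneg _)
  nlinarith

/-- The smallest and largest elements of `J` contribute at least `d_1 + d_2`, every other one at
least `1`. -/
theorem le_sum_of_two_le_card (h₀ : 0 < n) (h₁ : 1 < n) (hd : Monotone d) (hd1 : ∀ i, 1 ≤ d i)
    {J : Finset (Fin n)} (hJ : 2 ≤ J.card) :
    (d ⟨0, h₀⟩ : ℤ) + d ⟨1, h₁⟩ + (J.card - 2) ≤ ∑ i ∈ J, (d i : ℤ) := by
  have hne : J.Nonempty := Finset.card_pos.1 (by omega)
  set t := J.max' hne with ht
  have htJ : t ∈ J := J.max'_mem hne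
  set b := J.min' hne with hb
  have hbJ : b ∈ J := J.min'_mem hne
  have hbt : (b : ℕ) < t := J.min'_lt_max'_of_card hJ
  have hbJ' : b ∈ J.erase t := Finset.mem_erase.2 ⟨fun h => hbt.ne (congrArg Fin.val h), hbJ⟩
  have h1 : (d ⟨1, h₁⟩ : ℤ) ≤ d t := by
    have h : (⟨1, h₁⟩ : Fin n) ≤ t := Fin.le_def.2 (by change 1 ≤ (t : ℕ); omega)
    exact_mod_cast hd h
  have h2 : (d ⟨0, h₀⟩ : ℤ) ≤ d b := by
    have h : (⟨0, h₀⟩ : Fin n) ≤ b := Fin.le_def.2 (Nat.zero_le _)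
    exact_mod_cast hd h
  have h3 := card_le_sum_degrees hd1 ((J.erase t).erase b)
  rw [Finset.card_erase_of_mem hbJ', Finset.card_erase_of_mem htJ, Nat.sub_sub,
    Nat.cast_sub hJ] at h3
  rw [← Finset.add_sum_erase J _ htJ, ← Finset.add_sum_erase _ _ hbJ']
  push_cast at h3
  linarith

/-- Outside of the interval of non-rigidity the degrees of the obstructions are negative or
exceed the socle degree. -/
theorem degree_lt_or_lt (h₀ : 0 < n) (h₁ : 1 < n) (h₂ : n - 2 < n) (h₃ : n - 1 < n)
    (hd : Monotone d) (hd1 : ∀ i, 1 ≤ d i) {a : ℤ}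
    (ha : ¬((d ⟨0, h₀⟩ : ℤ) + d ⟨1, h₁⟩ + n - ∑ i, (d i : ℤ) ≤ a ∧
      a ≤ (d ⟨n - 2, h₂⟩ : ℤ) + d ⟨n - 1, h₃⟩))
    {J : Finset (Fin n)} (hJ : 2 ≤ J.card) :
    ∑ i ∈ J, (d i : ℤ) - (J.card - 1) * a < 0 ∨
      ∑ i, (d i : ℤ) - n < ∑ i ∈ J, (d i : ℤ) - (J.card - 1) * a := by
  have hJ' : (2 : ℤ) ≤ J.card := by exact_mod_cast hJ
  rcases lt_or_ge a ((d ⟨0, h₀⟩ : ℤ) + d ⟨1, h₁⟩ + n - ∑ i, (d i : ℤ)) with h | h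
  · right
    have h1 := le_sum_of_two_le_card h₀ h₁ hd hd1 hJ
    have h2 := sum_sub_one_le hd1 {(⟨0, h₀⟩ : Fin n), ⟨1, h₁⟩}
    rw [Finset.sum_pair (by simp), Finset.card_pair (by simp)] at h2
    push_cast at h2
    -- The left endpoint of the interval is at most `2`, so `a ≤ 1` and each element of `J` beyond
    -- two costs at most the `1` that it contributes to the sum.
    have h3 : a ≤ 1 := by linarith
    have h4 : ((J.card : ℤ) - 2) * a ≤ ((J.card : ℤ) - 2) * 1 :=
      mul_le_mul_of_nonneg_left h3 (by linarith)
    linarith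
  · left
    have h1 := sum_le_of_two_le_card h₂ h₃ hd hJ
    have h2 : (d ⟨n - 2, h₂⟩ : ℤ) + d ⟨n - 1, h₃⟩ < a := by
      by_contra hcon
      exact ha ⟨h, not_lt.1 hcon⟩
    have h3 := mul_lt_mul_of_pos_left h2 (show (0 : ℤ) < J.card - 1 by linarith)
    linarith

end Numerics

/-! ### From Mathlib's regular sequences to the elementwise condition. -/

section Regular

variable {R : Type*} [CommRing R] {n : ℕ} {f : Fin n → R}

theorem ofList_take_ofFn (f : Fin n → R) (r : ℕ) :
    Ideal.ofList ((List.ofFn f).take r) = Ideal.span (f '' {i | (i : ℕ) < r}) := by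
  unfold Ideal.ofList
  congr 1
  ext x
  simp only [Set.mem_ofPred_eq, List.mem_take_iff_getElem, List.getElem_ofFn, List.length_ofFn,
    Set.mem_image]
  constructor
  · rintro ⟨j, hj, rfl⟩
    exact ⟨⟨j, by omega⟩, by simp; omega, rfl⟩
  · rintro ⟨i, hi, rfl⟩
    exact ⟨i, by have := i.2; omega, rfl⟩

theorem mem_span_of_isRegular (h : RingTheory.Sequence.IsRegular R (List.ofFn f)) (r : Fin n)
    (c : R) (hc : f r * c ∈ Ideal.span (f '' {i | (i : ℕ) < r})) :
    c ∈ Ideal.span (f '' {i | (i : ℕ) < r}) := by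
  have h1 := h.regular_mod_prev r (by simp)
  rw [isSMulRegular_quotient_iff_mem_of_smul_mem] at h1
  have h2 := h1 c
  rw [ofList_take_ofFn, smul_eq_mul, Ideal.mul_top, List.getElem_ofFn] at h2
  exact h2 hc

theorem span_ne_top_of_isRegular (h : RingTheory.Sequence.IsRegular R (List.ofFn f)) :
    Ideal.span (Set.range f) ≠ ⊤ := by
  have h1 := h.top_ne_smul
  rw [smul_eq_mul, Ideal.mul_top] at h1
  have h2 : Ideal.ofList (List.ofFn f) = Ideal.span (Set.range f) := by
    unfold Ideal.ofList
    congr 1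
    ext x
    simp
  rw [h2] at h1
  exact h1.symm

end Regular

/-- A form of degree zero in a proper ideal is zero, and zero is not regular modulo a proper ideal.
-/
theorem one_le_degree {k : Type u} [Field k] {n : ℕ} {f : Fin n → MvPolynomial (Fin n) k}
    {d : Fin n → ℕ} (hf : ∀ i, (f i).IsHomogeneous (d i))
    (hreg : ∀ (r : Fin n) (c : MvPolynomial (Fin n) k),
      f r * c ∈ Ideal.span (f '' {i | (i : ℕ) < r}) → c ∈ Ideal.span (f '' {i | (i : ℕ) < r}))
    (htop : Ideal.span (Set.range f) ≠ ⊤) (i : Fin n) : 1 ≤ d i := by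
  by_contra hdi
  have h0 : f i = 0 := eq_zero_of_mem_of_mem_polyGrading htop (m := d i) (by omega)
    (mem_polyGrading_natCast.2 (hf i)) (Ideal.subset_span ⟨i, rfl⟩)
  have h1 := hreg i 1 (by rw [h0, zero_mul]; exact zero_mem _)
  exact htop ((Ideal.eq_top_iff_one _).2 (Ideal.span_mono (Set.image_subset_range _ _) h1))

end DiffMod

theorem mainTheorem6 {k : Type u} [Field k] (n : ℕ) (hn : 2 ≤ n)
    (f : Fin n → MvPolynomial (Fin n) k) (d : Fin n → ℕ)
    (hf : ∀ i, (f i).IsHomogeneous (d i)) (hd : Monotone d)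
    (hreg : RingTheory.Sequence.IsRegular (MvPolynomial (Fin n) k) (List.ofFn f)) (a : ℤ) :
    ¬ DiffMod.IsRigidModule k (Fin n)
        (DiffMod.quotientGrading (Ideal.span (Set.range f))) a ↔
      (d ⟨0, by omega⟩ : ℤ) + d ⟨1, by omega⟩ + n - ∑ i, (d i : ℤ) ≤ a ∧
        a ≤ (d ⟨n - 2, by omega⟩ : ℤ) + d ⟨n - 1, by omega⟩ := by
  have hreg' := DiffMod.mem_span_of_isRegular hreg
  have htop := DiffMod.span_ne_top_of_isRegular hreg
  have hd1 := DiffMod.one_le_degree hf hreg' htop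
  constructor
  · intro h
    by_contra ha
    refine h ⟨DiffMod.Koszul.complex f d hf, DiffMod.Koszul.augmentation hf,
      DiffMod.Koszul.complex_isResolution hf hreg',
      DiffMod.Koszul.complex_isRigid hf hreg' a fun J hJ g hg => ?_⟩
    rcases DiffMod.degree_lt_or_lt _ _ _ _ hd hd1 ha hJ with hlt | hlt
    · rw [DiffMod.eq_zero_of_mem_polyGrading_of_neg hlt hg]
      exact zero_mem _
    · exact DiffMod.mem_span_of_lt (by omega) hf hd1 hreg' htop hlt hg
  · rintro ⟨h1, h2⟩ ⟨F, ε, hF, hrig⟩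
    obtain ⟨i, j, hij, h0, hs⟩ := DiffMod.exists_pair _ _ _ _ hd1 h1 h2
    obtain ⟨g, hg, hgI⟩ := DiffMod.exists_notMem_span_of_le (by omega) hf hd1 hreg' htop h0 hs
    exact hgI (DiffMod.Koszul.mem_span_of_isRigid hf hreg' htop hF hrig hij hg)
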